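/- Let $0\le \rho_0,\rho_1,q<1$ and $0<\sigma\le 1$. Write $[n]_q=1+q+\dots+q^{n-1}$, $(a;q)_n=\prod_{k=0}^{n-1}(1-aq^k)$, $(a;q)_\infty=\prod_{k=0}^{\infty}(1-aq^k)$, with the convention $0^0=1$. A Motzkin path of length $L$ is a sequence $\gamma=(\gamma_0,\dots,\gamma_L)$ of non-negative integers with $\gamma_j-\gamma_{j-1}\in\{-1,0,1\}$ for $1\le j\le L$, and $H(\gamma)=\#\{1\le j\le L:\gamma_j=\gamma_{j-1}\}$ is its number of horizontal steps. Let $\gamma^{(L)}$ be a random Motzkin path of length $L$ with law $$\Pr\nolimits_L(\gamma)=\frac{1}{\mathfrak C_L}\,\rho_0^{\gamma_0}\rho_1^{\gamma_L}(2\sigma)^{H(\gamma)}\prod_{k=0}^{L}[\gamma_k+1]_q,$$ where $\mathfrak C_L\in(0,\infty)$ is the normalizing constant. Regard $\gamma^{(L)}$ as an infinite sequence by setting $\gamma^{(L)}_k=0$ for $k>L$, and let $\widetilde\gamma^{(L)}_k=\gamma^{(L)}_{L-k}$ for $0\le k\le L$ and $\widetilde\gamma^{(L)}_k=0$ for $k>L$.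 Put $a=-q(\sigma+i\sqrt{1-\sigma^2})$, $b=-q(\sigma-i\sqrt{1-\sigma^2})$, $s_{-1}=0$, $$s_n=\sum_{k=0}^n\frac{(a;q)_k}{(q;q)_k}\,\frac{(b;q)_{n-k}}{(q;q)_{n-k}}\quad(n\ge 0),\qquad C_j=\frac{(a\rho_j;q)_\infty\,(b\rho_j;q)_\infty}{(\rho_j;q)_\infty^2}\quad(j=0,1);$$ these numbers are real. Then there exist two independent Markov chains $X=(X_k)_{k\ge0}$ and $Y=(Y_k)_{k\ge0}$ on $\mathbb Z_{\ge 0}$ with initial laws $$\Pr(X_0=n)=\frac{\rho_0^n s_n}{C_0},\qquad \Pr(Y_0=n)=\frac{\rho_1^n s_n}{C_1}\qquad(n\ge0),$$ and with the same transition probabilities: from $n\ge 0$ the chain moves to $n+1$, $n$, $n-1$ with probabilities $$\frac{1-q^{n+1}}{1+\sigma}\cdot\frac{s_{n+1}}{2s_n},\qquad \frac{1-q^{n+1}}{1+\sigma}\cdot\sigma,\qquad \frac{1-q^{n+1}}{1+\sigma}\cdot\frac{s_{n-1}}{2s_n},$$ respectively, and to no other state. Moreover, as $L\to\infty$, the pair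 $(\gamma^{(L)},\widetilde\gamma^{(L)})$ converges in distribution to $(X,Y)$, jointly, as random elements of $\mathbb Z_{\ge0}^{\mathbb N}\times\mathbb Z_{\ge0}^{\mathbb N}$ with the product topology (equivalently, all joint finite-dimensional distributions converge). -/

import Mathlib

open MeasureTheory ProbabilityTheory Filter Topology

noncomputable section

namespace QMotzkin

/-! # q-notation -/

/-- The `q`-number `[n]_q = 1 + q + ... + q^(n-1)`. -/
def qNumber (q : ℝ) (n : ℕ) : ℝ := ∑ i ∈ Finset.range n, q ^ i

/-- The finite `q`-Pochhammer symbol `(a; q)_n = ∏_{k=0}^{n-1} (1 - a q^k)`. -/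
def qPoch (a q : ℂ) (n : ℕ) : ℂ := ∏ k ∈ Finset.range n, (1 - a * q ^ k)

/-- The infinite `q`-Pochhammer symbol `(a; q)_∞ = ∏_{k=0}^∞ (1 - a q^k)`. -/
def qPochInf (a q : ℂ) : ℂ := ∏' k : ℕ, (1 - a * q ^ k)

/-- For `|q| < 1` the infinite product defining `(a; q)_∞` converges (unconditionally), and it is
the limit of the finite products. -/
theorem multipliable_qPochInf (a : ℂ) {q : ℂ} (hq : ‖q‖ < 1) :
    Multipliable fun k : ℕ => 1 - a * q ^ k := by
  have h : Summable fun k : ℕ => ‖-(a * q ^ k)‖ := by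
    simp only [norm_neg, norm_mul, norm_pow]
    exact (summable_geometric_of_lt_one (norm_nonneg q) hq).mul_left _
  simpa [sub_eq_add_neg] using multipliable_one_add_of_summable h

/-! # Random Motzkin paths -/

/-- Motzkin paths of length `L`, given by their altitudes `γ 0, ..., γ L` (non-negative integers
with consecutive differences in `{-1, 0, 1}`). -/
def MotzkinPath (L : ℕ) : Type :=
  {γ : Fin (L + 1) → ℕ // ∀ j : Fin L, |(γ j.succ : ℤ) - (γ j.castSucc : ℤ)| ≤ 1}

instance (L : ℕ) : MeasurableSpace (MotzkinPath L) := ⊤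

/-- The number of horizontal steps of a path. -/
def MotzkinPath.horizontalSteps {L : ℕ} (γ : MotzkinPath L) : ℕ :=
  (Finset.univ.filter fun j : Fin L => γ.1 j.succ = γ.1 j.castSucc).card

/-- The unnormalized weight
`ρ₀^{γ_0} ρ₁^{γ_L} (2σ)^{H(γ)} ∏_{k=0}^{L} [γ_k + 1]_q` of a path. -/
def motzkinWeight (q σ ρ₀ ρ₁ : ℝ) {L : ℕ} (γ : MotzkinPath L) : ℝ :=
  ρ₀ ^ γ.1 0 * ρ₁ ^ γ.1 (Fin.last L) * (2 * σ) ^ γ.horizontalSteps *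
    ∏ k : Fin (L + 1), qNumber q (γ.1 k + 1)

/-- The normalizing constant: the total weight of all Motzkin paths of length `L`. -/
def motzkinNorm (q σ ρ₀ ρ₁ : ℝ) (L : ℕ) : ℝ :=
  ∑' γ : MotzkinPath L, motzkinWeight q σ ρ₀ ρ₁ γ

/-- The discrete measure on Motzkin paths of length `L` which gives the path `γ` the mass
`motzkinWeight γ / motzkinNorm L`. -/
def motzkinLaw (q σ ρ₀ ρ₁ : ℝ) (L : ℕ) : Measure (MotzkinPath L) :=
  Measure.sum fun γ : MotzkinPath L =>
    ENNReal.ofReal (motzkinWeight q σ ρ₀ ρ₁ γ / motzkinNorm q σ ρ₀ ρ₁ L) • Measure.dirac γ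

/-- The sequence of altitudes read from the initial point, continued by `0` after time `L`. -/
def MotzkinPath.fromStart {L : ℕ} (γ : MotzkinPath L) : ℕ → ℕ := fun k =>
  if h : k ≤ L then γ.1 ⟨k, Nat.lt_succ_of_le h⟩ else 0

/-- The sequence of altitudes read backwards from the final point (`k ↦ γ_{L-k}` for `k ≤ L`),
continued by `0` after time `L`. -/
def MotzkinPath.fromEnd {L : ℕ} (γ : MotzkinPath L) : ℕ → ℕ := fun k =>
  if k ≤ L then γ.1 ⟨L - k, Nat.lt_succ_of_le (Nat.sub_le L k)⟩ else 0

/-! # The limiting Markov chains -/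

/-- `a = -q (σ + i √(1 - σ²))`. -/
def paramA (q σ : ℝ) : ℂ := -(q : ℂ) * ((σ : ℂ) + Complex.I * (√(1 - σ ^ 2) : ℝ))

/-- `b = -q (σ - i √(1 - σ²))`. -/
def paramB (q σ : ℝ) : ℂ := -(q : ℂ) * ((σ : ℂ) - Complex.I * (√(1 - σ ^ 2) : ℝ))

/-- `s_n = ∑_{k=0}^n (a; q)_k / (q; q)_k * (b; q)_{n-k} / (q; q)_{n-k}` as a complex number. -/
def sComplex (q σ : ℝ) (n : ℕ) : ℂ :=
  ∑ k ∈ Finset.range (n + 1),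
    qPoch (paramA q σ) q k / qPoch q q k * (qPoch (paramB q σ) q (n - k) / qPoch q q (n - k))

/-- The number `s_n` as a real number; no information is lost, see `ofReal_s`. -/
def s (q σ : ℝ) (n : ℕ) : ℝ := (sComplex q σ n).re

/-- `C(ρ) = (aρ, bρ; q)_∞ / (ρ; q)_∞²` as a complex number. -/
def normComplex (q σ ρ : ℝ) : ℂ :=
  qPochInf (paramA q σ * ρ) q * qPochInf (paramB q σ * ρ) q / qPochInf ρ q ^ 2

/-- The number `C(ρ)` as a real number; no information is lost, see `ofReal_normConst`. -/
def normConst (q σ ρ : ℝ) : ℝ := (normComplex q σ ρ).re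

theorem conj_paramA (q σ : ℝ) : (starRingEnd ℂ) (paramA q σ) = paramB q σ := by
  simp [paramA, paramB, sub_eq_add_neg]

theorem conj_paramB (q σ : ℝ) : (starRingEnd ℂ) (paramB q σ) = paramA q σ := by
  rw [← conj_paramA, Complex.conj_conj]

theorem conj_qPoch (a : ℂ) (q : ℝ) (n : ℕ) :
    (starRingEnd ℂ) (qPoch a q n) = qPoch ((starRingEnd ℂ) a) q n := by
  simp [qPoch, map_prod]

theorem conj_qPochInf (a : ℂ) {q : ℝ} (hq : |q| < 1) :
    (starRingEnd ℂ) (qPochInf a q) = qPochInf ((starRingEnd ℂ) a) q := by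
  have h := (multipliable_qPochInf a (q := (q : ℂ)) (by simpa using hq)).map_tprod
    (starRingEnd ℂ) Complex.continuous_conj
  simpa [qPochInf] using h

/-- The complex numbers `s_n` are real. -/
theorem ofReal_s (q σ : ℝ) (n : ℕ) : ((s q σ n : ℝ) : ℂ) = sComplex q σ n := by
  refine Complex.conj_eq_iff_re.mp ?_
  have hq : (starRingEnd ℂ) (q : ℂ) = q := Complex.conj_ofReal q
  simp only [sComplex, map_sum, map_mul, map_div₀, conj_qPoch, conj_paramA, conj_paramB, hq]
  rw [← Finset.sum_range_reflect]
  refine Finset.sum_congr rfl fun k hk => ?_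
  have hk' : k ≤ n := Nat.lt_succ_iff.mp (Finset.mem_range.mp hk)
  have h1 : n + 1 - 1 - k = n - k := by omega
  have h2 : n - (n - k) = k := by omega
  rw [h1, h2, mul_comm]

/-- The complex number `C(ρ)` is real. -/
theorem ofReal_normConst {q : ℝ} (hq : |q| < 1) (σ ρ : ℝ) :
    ((normConst q σ ρ : ℝ) : ℂ) = normComplex q σ ρ := by
  refine Complex.conj_eq_iff_re.mp ?_
  simp only [normComplex, map_mul, map_div₀, map_pow, conj_qPochInf _ hq, conj_paramA,
    conj_paramB, Complex.conj_ofReal]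
  rw [mul_comm (qPochInf (paramB q σ * ρ) q)]

/-- The transition probabilities from `n` to `m`. The term with `s_{-1} = 0` does not occur, since
the state space is `ℕ`. -/
def transitionProb (q σ : ℝ) (n m : ℕ) : ℝ :=
  (1 - q ^ (n + 1)) / (1 + σ) *
    if m = n + 1 then s q σ m / (2 * s q σ n)
    else if m = n then σ
    else if m + 1 = n then s q σ m / (2 * s q σ n)
    else 0

/-- The initial law `n ↦ ρ^n s_n / C(ρ)`. -/
def initialProb (q σ ρ : ℝ) (n : ℕ) : ℝ := ρ ^ n * s q σ n / normConst q σ ρ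

/-- `X` is a (time-homogeneous) Markov chain on `ℕ` under `P` with initial law `init` and
transition probabilities `p`: given any history `X_0 = x_0, ..., X_k = x_k` of positive
probability, the conditional probability of `X_{k+1} = m` is `p (x_k) m`. -/
structure IsMarkovChain {Ω : Type*} [MeasurableSpace Ω] (P : Measure Ω) (X : ℕ → Ω → ℕ)
    (init : ℕ → ℝ) (p : ℕ → ℕ → ℝ) : Prop where
  measurable : ∀ k, Measurable (X k)
  initial : ∀ n, P.real {ω | X 0 ω = n} = init n
  transition : ∀ (k : ℕ) (x : ℕ → ℕ) (m : ℕ), P {ω | ∀ j ≤ k, X j ω = x j} ≠ 0 →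
    (ProbabilityTheory.cond P {ω | ∀ j ≤ k, X j ω = x j}).real {ω | X (k + 1) ω = m} = p (x k) m

/-- `X` and `Y` are independent Markov chains under `P`, with the transition probabilities
`transitionProb q σ` and the initial laws `initialProb q σ ρ₀` and `initialProb q σ ρ₁`. -/
structure IsLimitPair {Ω : Type*} [MeasurableSpace Ω] (P : Measure Ω) (X Y : ℕ → Ω → ℕ)
    (q σ ρ₀ ρ₁ : ℝ) : Prop where
  left : IsMarkovChain P X (initialProb q σ ρ₀) (transitionProb q σ)
  right : IsMarkovChain P Y (initialProb q σ ρ₁) (transitionProb q σ)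
  indep : IndepFun (fun ω k => X k ω) (fun ω k => Y k ω) P

end QMotzkin

end

/-! Since [n+1]_q = (1-q^(n+1))/(1-q), a path weight is, up to a power of 1-q that cancels in the
normalization, a product of boundary factors, site weights d_n = 1-q^(n+1) and step weights 1, 2σ,
1. Once the first and the last k+1 altitudes are fixed, only the kernel K_M = `pathKernel` of the
middle M = L-2k steps is left, so everything rests on the asymptotics of K_L(m,n).

This kernel is generated by f ↦ d_n (f(n+1) + 2σ f(n) + f(n-1)), which is symmetric with respect to
the weights 1/d_n. Let p_n(x) = `orthPoly` be its formal eigenvectors and Λ = 2+2σ. Diagonalizing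
finite truncations gives K_L(m,n) = ∑ w_i x_i^L p_m(x_i) p_n(x_i) with nodes in [2σ-2, Λ]
(`exists_quadrature`, `pathKernel_eq_sum`). As ∑ (n+1)(1/d_n - 1) < ∞, the p_n grow at most
linearly, uniformly on this interval. Hence K_L(m,n) ≤ C(m+1)(n+1) K_L(0,0), and testing against
p_n(Λ) gives K_L(0,0) ≥ cΛ^L/(L+1)^3. Because σ > 0, nodes away from Λ have modulus at most some r <
Λ, so they become negligible and K_{L+1}(0,0)/K_L(0,0) → Λ. The recurrence turns this into
K_L(m,n)/K_L(0,0) → p_m(Λ) p_n(Λ) (`tendsto_pathKernel_div`); this product form is the asymptotic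
independence of the two ends.

By the q-binomial theorem the generating function F of s is a product of two q-binomial series, with
(1-t)^2 F(t) = (1-at)(1-bt) F(qt) and ∑ ρ^n s_n = C(ρ). Read on coefficients, this is the recurrence
of p_n(Λ), so s_n = p_n(Λ). The limiting cylinder probabilities are therefore those of the Doob
transform of the operator by its positive eigenvector s, and cylinders determine weak convergence.
-/

noncomputable section

namespace QMotzkin

section

/-! # The `q`-binomial theorem and the generating function of `s` -/

/-- The coefficient `(a; q)_k / (q; q)_k` of the `q`-binomial series. -/
def qBinomCoeff (a q : ℂ) (k : ℕ) : ℂ := qPoch a q k / qPoch q q k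

theorem qPoch_succ (a q : ℂ) (n : ℕ) : qPoch a q (n + 1) = qPoch a q n * (1 - a * q ^ n) :=
  Finset.prod_range_succ _ _

theorem qBinomCoeff_zero (a q : ℂ) : qBinomCoeff a q 0 = 1 := by simp [qBinomCoeff, qPoch]

theorem one_sub_pow_succ_ne_zero {q : ℂ} (hq : ‖q‖ < 1) (n : ℕ) : 1 - q ^ (n + 1) ≠ 0 := by
  intro h
  have h1 : ‖q ^ (n + 1)‖ = 1 := by rw [← sub_eq_zero.mp h, norm_one]
  rw [norm_pow] at h1
  exact absurd h1 (pow_lt_one₀ (norm_nonneg q) hq n.succ_ne_zero).ne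

theorem qBinomCoeff_succ (a : ℂ) {q : ℂ} (hq : ‖q‖ < 1) (n : ℕ) :
    (1 - q ^ (n + 1)) * qBinomCoeff a q (n + 1) = (1 - a * q ^ n) * qBinomCoeff a q n := by
  have h := one_sub_pow_succ_ne_zero hq n
  rw [qBinomCoeff, qBinomCoeff, qPoch_succ, qPoch_succ, ← pow_succ']
  have h2 : qPoch q q n ≠ 0 := by
    refine Finset.prod_ne_zero_iff.mpr fun k _ => ?_
    rw [← pow_succ']
    exact one_sub_pow_succ_ne_zero hq k
  field_simp

/-- Ratio test: since q^n → 0, the quotient of consecutive terms tends to t. -/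
theorem summable_norm_qBinomCoeff_mul_pow (a : ℂ) {q t : ℂ} (hq : ‖q‖ < 1) (ht : ‖t‖ < 1) :
    Summable fun k => ‖qBinomCoeff a q k * t ^ k‖ := by
  obtain ⟨r, htr, hr⟩ := exists_between ht
  have hpow : Tendsto (fun n : ℕ => q ^ n) atTop (𝓝 0) :=
    tendsto_pow_atTop_nhds_zero_of_norm_lt_one hq
  have hlim : Tendsto (fun n : ℕ => ‖(1 - a * q ^ n) / (1 - q ^ (n + 1)) * t‖) atTop (𝓝 ‖t‖) := by
    have h1 : Tendsto (fun n : ℕ => (1 - a * q ^ n) / (1 - q ^ (n + 1)) * t) atTop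
        (𝓝 ((1 - a * 0) / (1 - 0) * t)) :=
      (((tendsto_const_nhds.sub (hpow.const_mul a)).div
        (tendsto_const_nhds.sub ((tendsto_add_atTop_iff_nat 1).mpr hpow)) (by simp)).mul_const t)
    simpa using h1.norm
  refine summable_of_ratio_norm_eventually_le (r := r) hr ?_
  filter_upwards [hlim.eventually (gt_mem_nhds htr)] with n hn
  have hrec : qBinomCoeff a q (n + 1) * t ^ (n + 1) =
      (1 - a * q ^ n) / (1 - q ^ (n + 1)) * t * (qBinomCoeff a q n * t ^ n) := by
    have h := one_sub_pow_succ_ne_zero hq n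
    rw [pow_succ, div_mul_eq_mul_div, div_mul_eq_mul_div, eq_div_iff h]
    linear_combination t ^ n * t * qBinomCoeff_succ a hq n
  rw [norm_norm, norm_norm, hrec, norm_mul]
  exact mul_le_mul_of_nonneg_right hn.le (norm_nonneg _)

/-- This is the coefficient recursion `qBinomCoeff_succ`, multiplied by t^(k+1) and summed over k.
-/
theorem tsum_qBinomCoeff_functional_eq (a : ℂ) {q t : ℂ} (hq : ‖q‖ < 1) (ht : ‖t‖ < 1) :
    (1 - t) * ∑' k, qBinomCoeff a q k * t ^ k =
      (1 - a * t) * ∑' k, qBinomCoeff a q k * (q * t) ^ k := by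
  have hqt : ‖q * t‖ < 1 := by
    rw [norm_mul]; exact mul_lt_one_of_nonneg_of_lt_one_left (norm_nonneg _) hq ht.le
  have h1 := (summable_norm_qBinomCoeff_mul_pow a hq ht).of_norm
  have h2 := (summable_norm_qBinomCoeff_mul_pow a hq hqt).of_norm
  have e1 := h1.tsum_eq_zero_add
  have e2 := h2.tsum_eq_zero_add
  have h1' := (summable_nat_add_iff 1).mpr h1
  have h2' := (summable_nat_add_iff 1).mpr h2
  have key : (∑' k, qBinomCoeff a q (k + 1) * t ^ (k + 1)) -
      ∑' k, qBinomCoeff a q (k + 1) * (q * t) ^ (k + 1) =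
      t * (∑' k, qBinomCoeff a q k * t ^ k) - a * t * ∑' k, qBinomCoeff a q k * (q * t) ^ k := by
    rw [← h1'.tsum_sub h2', ← tsum_mul_left, ← tsum_mul_left,
      ← (h1.mul_left t).tsum_sub (h2.mul_left (a * t))]
    refine tsum_congr fun k => ?_
    rw [mul_pow, mul_pow]
    linear_combination t ^ (k + 1) * qBinomCoeff_succ a hq k
  simp only [qBinomCoeff_zero, pow_zero, mul_one] at e1 e2
  linear_combination e1 - e2 + key

theorem tendsto_qPoch (a : ℂ) {q : ℂ} (hq : ‖q‖ < 1) :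
    Tendsto (qPoch a q) atTop (𝓝 (qPochInf a q)) :=
  (multipliable_qPochInf a hq).hasProd.tendsto_prod_nat

theorem qPochInf_ne_zero {a q : ℂ} (ha : ‖a‖ < 1) (hq : ‖q‖ < 1) : qPochInf a q ≠ 0 := by
  have hs : Summable fun k : ℕ => ‖-(a * q ^ k)‖ := by
    simp only [norm_neg, norm_mul, norm_pow]
    exact (summable_geometric_of_lt_one (norm_nonneg q) hq).mul_left _
  have h := tprod_one_add_ne_zero_of_summable (f := fun k : ℕ => -(a * q ^ k)) (fun k hk => ?_) hs
  · simpa [qPochInf, sub_eq_add_neg] using h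
  · have h1 : a * q ^ k = 1 := by linear_combination -hk
    have h2 : ‖a * q ^ k‖ < 1 := by
      rw [norm_mul, norm_pow]
      exact mul_lt_one_of_nonneg_of_lt_one_left (norm_nonneg _) ha
        (pow_le_one₀ (norm_nonneg _) hq.le)
    rw [h1, norm_one] at h2
    exact lt_irrefl _ h2

/-- The **`q`-binomial theorem**. -/
theorem tsum_qBinomCoeff (a : ℂ) {q t : ℂ} (hq : ‖q‖ < 1) (ht : ‖t‖ < 1) :
    ∑' k, qBinomCoeff a q k * t ^ k = qPochInf (a * t) q / qPochInf t q := by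
  have hlt : ∀ n, ‖q ^ n * t‖ < 1 := fun n => by
    rw [norm_mul, norm_pow]
    exact mul_lt_one_of_nonneg_of_lt_one_right (pow_le_one₀ (norm_nonneg _) hq.le)
      (norm_nonneg _) ht
  -- Iterating the functional equation moves the argument from t to q^n t, where the series tends to
  -- its constant term 1.
  have hiter : ∀ n, qPoch t q n * ∑' k, qBinomCoeff a q k * t ^ k =
      qPoch (a * t) q n * ∑' k, qBinomCoeff a q k * (q ^ n * t) ^ k := by
    intro n
    induction n with
    | zero => simp [qPoch]
    | succ n ih =>
      have h := tsum_qBinomCoeff_functional_eq a hq (hlt n)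
      rw [← mul_assoc q, ← pow_succ'] at h
      rw [qPoch_succ, qPoch_succ]
      linear_combination (1 - t * q ^ n) * ih + qPoch (a * t) q n * h
  have hlim : Tendsto (fun n : ℕ => ∑' k, qBinomCoeff a q k * (q ^ n * t) ^ k) atTop
      (𝓝 (∑' k, qBinomCoeff a q k * 0 ^ k)) := by
    refine tendsto_tsum_of_dominated_convergence (summable_norm_qBinomCoeff_mul_pow a hq ht)
      (fun k => ?_) (.of_forall fun n k => ?_)
    · have h := (tendsto_pow_atTop_nhds_zero_of_norm_lt_one hq).mul_const t
      rw [zero_mul] at h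
      exact (h.pow k).const_mul _
    · rw [norm_mul, norm_mul, norm_pow, norm_pow, norm_mul]
      refine mul_le_mul_of_nonneg_left (pow_le_pow_left₀ (by positivity) ?_ _) (norm_nonneg _)
      rw [norm_pow]
      exact mul_le_of_le_one_left (norm_nonneg _) (pow_le_one₀ (norm_nonneg _) hq.le)
  have h0 : ∑' k, qBinomCoeff a q k * 0 ^ k = 1 := by
    rw [tsum_eq_single 0 fun k hk => by simp [hk]]
    simp [qBinomCoeff_zero]
  rw [h0] at hlim
  have hA := (tendsto_qPoch t hq).mul_const (∑' k, qBinomCoeff a q k * t ^ k)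
  have hB := (tendsto_qPoch (a * t) hq).mul hlim
  have h := tendsto_nhds_unique hA (hB.congr fun n => (hiter n).symm)
  rw [eq_div_iff (qPochInf_ne_zero ht hq)]
  linear_combination h

/-! ### The three-term recurrence for `s` -/

theorem paramA_add_paramB (q σ : ℝ) : paramA q σ + paramB q σ = -(2 * q * σ) := by
  rw [paramA, paramB]; ring

theorem paramA_mul_paramB {q σ : ℝ} (hσ₀ : 0 ≤ σ) (hσ₁ : σ ≤ 1) :
    paramA q σ * paramB q σ = q ^ 2 := by
  have h : ((√(1 - σ ^ 2) : ℝ) : ℂ) ^ 2 = 1 - (σ : ℂ) ^ 2 := by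
    rw [← Complex.ofReal_pow, Real.sq_sqrt (by nlinarith)]; simp
  rw [paramA, paramB]
  linear_combination (-(q : ℂ) ^ 2 * Complex.I ^ 2) * h + (q : ℂ) ^ 2 * (σ ^ 2 - 1) * Complex.I_sq

theorem sComplex_zero (q σ : ℝ) : sComplex q σ 0 = 1 := by
  simp [sComplex, qPoch]

theorem s_zero (q σ : ℝ) : s q σ 0 = 1 := by simp [s, sComplex_zero]

/-- The `q`-binomial series as a formal power series. -/
def qBinomSeries (a q : ℂ) : PowerSeries ℂ := PowerSeries.mk (qBinomCoeff a q)

/-- The formal version of the functional equation, which permits comparing coefficients without any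
convergence. -/
theorem qBinomSeries_functional_eq (a : ℂ) {q : ℂ} (hq : ‖q‖ < 1) :
    (1 - PowerSeries.X) * qBinomSeries a q =
      (1 - PowerSeries.C a * PowerSeries.X) * PowerSeries.rescale q (qBinomSeries a q) := by
  ext n
  rcases n with _ | n
  · rw [sub_mul, sub_mul, one_mul, one_mul, mul_assoc, map_sub, map_sub, PowerSeries.coeff_C_mul,
      PowerSeries.coeff_zero_X_mul, PowerSeries.coeff_zero_X_mul, PowerSeries.coeff_rescale]
    simp
  · rw [sub_mul, sub_mul, one_mul, one_mul, mul_assoc, map_sub, map_sub, PowerSeries.coeff_C_mul,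
      PowerSeries.coeff_succ_X_mul, PowerSeries.coeff_succ_X_mul]
    simp only [PowerSeries.coeff_rescale, qBinomSeries, PowerSeries.coeff_mk]
    linear_combination qBinomCoeff_succ a hq n

theorem coeff_qBinomSeries_mul (q σ : ℝ) (n : ℕ) :
    PowerSeries.coeff n (qBinomSeries (paramA q σ) q * qBinomSeries (paramB q σ) q) =
      sComplex q σ n := by
  rw [PowerSeries.coeff_mul, Finset.Nat.sum_antidiagonal_eq_sum_range_succ_mk, sComplex]
  simp [qBinomSeries, qBinomCoeff]

/-- The product of the functional equations of the two q-binomial series; a and b enter only through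
a+b = -2qσ and ab = q². -/
theorem sComplex_functional_eq {q σ : ℝ} (hq : |q| < 1) (hσ₀ : 0 ≤ σ) (hσ₁ : σ ≤ 1) :
    PowerSeries.mk (sComplex q σ) - PowerSeries.C 2 * (PowerSeries.X * PowerSeries.mk (sComplex q σ))
        + PowerSeries.X * (PowerSeries.X * PowerSeries.mk (sComplex q σ)) =
      PowerSeries.rescale (q : ℂ) (PowerSeries.mk (sComplex q σ))
        + PowerSeries.C (2 * q * σ : ℂ) *
          (PowerSeries.X * PowerSeries.rescale (q : ℂ) (PowerSeries.mk (sComplex q σ)))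
        + PowerSeries.C (q ^ 2 : ℂ) * (PowerSeries.X *
          (PowerSeries.X * PowerSeries.rescale (q : ℂ) (PowerSeries.mk (sComplex q σ)))) := by
  have hq' : ‖(q : ℂ)‖ < 1 := by simpa using hq
  have h : PowerSeries.mk (sComplex q σ) =
      qBinomSeries (paramA q σ) q * qBinomSeries (paramB q σ) q := by
    ext n; rw [coeff_qBinomSeries_mul, PowerSeries.coeff_mk]
  have hA := qBinomSeries_functional_eq (paramA q σ) hq'
  have hB := qBinomSeries_functional_eq (paramB q σ) hq'
  rw [← paramA_mul_paramB hσ₀ hσ₁, show (2 * q * σ : ℂ) = -(paramA q σ + paramB q σ) by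
    rw [paramA_add_paramB, neg_neg], h, map_mul, map_mul, map_neg, map_add, map_ofNat]
  linear_combination ((1 - PowerSeries.X) * qBinomSeries (paramB q σ) q) * hA +
    ((1 - PowerSeries.C (paramA q σ) * PowerSeries.X) *
      PowerSeries.rescale (q : ℂ) (qBinomSeries (paramA q σ) q)) * hB

theorem s_one {q σ : ℝ} (hq : |q| < 1) (hσ₀ : 0 ≤ σ) (hσ₁ : σ ≤ 1) :
    (1 - q) * (s q σ 1 + 2 * σ) = 2 + 2 * σ := by
  have h := congrArg (PowerSeries.coeff (0 + 1)) (sComplex_functional_eq hq hσ₀ hσ₁)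
  simp only [map_add, map_sub, PowerSeries.coeff_C_mul, PowerSeries.coeff_rescale,
    PowerSeries.coeff_mk, PowerSeries.coeff_succ_X_mul, PowerSeries.coeff_zero_X_mul, ← ofReal_s] at h
  have h' : s q σ 1 - 2 * s q σ 0 + 0 =
      q ^ 1 * s q σ 1 + 2 * q * σ * (q ^ 0 * s q σ 0) + q ^ 2 * 0 := by exact_mod_cast h
  rw [s_zero] at h'
  linear_combination h'

/-- The coefficient of t^(n+2) reads s_{n+2} - 2s_{n+1} + s_n = q^(n+2) (s_{n+2} + 2σ s_{n+1} +
s_n). Adding (2+2σ)s_{n+1} to both sides turns it into the eigenvalue equation at 2+2σ. -/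
theorem s_add_two {q σ : ℝ} (hq : |q| < 1) (hσ₀ : 0 ≤ σ) (hσ₁ : σ ≤ 1) (n : ℕ) :
    (1 - q ^ (n + 2)) * (s q σ (n + 2) + 2 * σ * s q σ (n + 1) + s q σ n) =
      (2 + 2 * σ) * s q σ (n + 1) := by
  have h := congrArg (PowerSeries.coeff (n + 2)) (sComplex_functional_eq hq hσ₀ hσ₁)
  simp only [map_add, map_sub, PowerSeries.coeff_C_mul, PowerSeries.coeff_rescale,
    PowerSeries.coeff_mk, PowerSeries.coeff_succ_X_mul, ← ofReal_s] at h
  have h' : s q σ (n + 2) - 2 * s q σ (n + 1) + s q σ n = q ^ (n + 2) * s q σ (n + 2) +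
      2 * q * σ * (q ^ (n + 1) * s q σ (n + 1)) + q ^ 2 * (q ^ n * s q σ n) := by
    exact_mod_cast h
  linear_combination h'

/-- The generating function of `s`. -/
theorem hasSum_s_mul_pow {q σ ρ : ℝ} (hq : |q| < 1) (hρ : |ρ| < 1) :
    HasSum (fun n => ρ ^ n * s q σ n) (normConst q σ ρ) := by
  have hq' : ‖(q : ℂ)‖ < 1 := by simpa using hq
  have hρ' : ‖(ρ : ℂ)‖ < 1 := by simpa using hρ
  have hA := summable_norm_qBinomCoeff_mul_pow (paramA q σ) hq' hρ'
  have hB := summable_norm_qBinomCoeff_mul_pow (paramB q σ) hq' hρ'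
  have h := tsum_mul_tsum_eq_tsum_sum_range_of_summable_norm hA hB
  have hs := (summable_norm_sum_mul_range_of_summable_norm hA hB).of_norm
  have hterm : ∀ n, ∑ k ∈ Finset.range (n + 1), qBinomCoeff (paramA q σ) q k * (ρ : ℂ) ^ k *
      (qBinomCoeff (paramB q σ) q (n - k) * (ρ : ℂ) ^ (n - k)) =
      ((ρ ^ n * s q σ n : ℝ) : ℂ) := by
    intro n
    rw [Complex.ofReal_mul, ofReal_s, sComplex, Finset.mul_sum]
    refine Finset.sum_congr rfl fun k hk => ?_
    have hk' : k ≤ n := Nat.lt_succ_iff.mp (Finset.mem_range.mp hk)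
    rw [Complex.ofReal_pow, ← pow_mul_pow_sub (ρ : ℂ) hk', qBinomCoeff, qBinomCoeff]
    ring
  simp only [hterm] at h hs
  have hval : ∑' n, ((ρ ^ n * s q σ n : ℝ) : ℂ) = (normConst q σ ρ : ℝ) := by
    rw [ofReal_normConst hq, normComplex, ← h, tsum_qBinomCoeff _ hq' hρ',
      tsum_qBinomCoeff _ hq' hρ']
    ring
  rw [← Complex.hasSum_ofReal, ← hval]
  exact hs.hasSum

end

section

/-! # The orthogonal polynomials of the weighted Motzkin operator -/

/-- The sum of `f` over the neighbours of a site, where the site itself counts with weight `c`. -/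
def motzkinStep {R : Type*} [Semiring R] (c : R) (f : ℕ → R) : ℕ → R
  | 0 => f 1 + c * f 0
  | m + 1 => f (m + 2) + c * f (m + 1) + f m

/-- The solution of `d n * (p (n + 1) + 2 σ p n + p (n - 1)) = x * p n` with `p 0 = 1`. -/
def orthPoly (d : ℕ → ℝ) (σ x : ℝ) : ℕ → ℝ
  | 0 => 1
  | 1 => x / d 0 - 2 * σ
  | n + 2 => (x / d (n + 1) - 2 * σ) * orthPoly d σ x (n + 1) - orthPoly d σ x n

/-- The assumptions on the site weights `d` under which the long paths are analysed. -/
structure Admissible (d : ℕ → ℝ) (σ : ℝ) : Prop where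
  pos : ∀ n, 0 < d n
  le_one : ∀ n, d n ≤ 1
  summable : Summable fun n : ℕ => (n + 1) * ((d n)⁻¹ - 1)
  sigma_pos : 0 < σ
  sigma_le_one : σ ≤ 1

variable {d : ℕ → ℝ} {σ x : ℝ}

theorem mul_motzkinStep_orthPoly (hd : ∀ n, 0 < d n) (n : ℕ) :
    d n * motzkinStep (2 * σ) (orthPoly d σ x) n = x * orthPoly d σ x n := by
  have h := (hd n).ne'
  rcases n with _ | n
  · simp only [motzkinStep, orthPoly]; field_simp; ring
  · simp only [motzkinStep, orthPoly]; field_simp; ring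

/-- The boundary equation at 0 leaves a single free parameter f 0 in this second-order recurrence.
It serves both for the eigenvectors of truncations and for s. -/
theorem eq_orthPoly_mul (hd : ∀ n, 0 < d n) {f : ℕ → ℝ} {N : ℕ}
    (hf : ∀ m < N, d m * motzkinStep (2 * σ) f m = x * f m) :
    ∀ m ≤ N, f m = orthPoly d σ x m * f 0 := by
  intro m
  induction m using Nat.twoStepInduction with
  | zero => intro _; simp [orthPoly]
  | one =>
    intro hm
    have h := hf 0 hm
    have h0 := (hd 0).ne'
    simp only [motzkinStep, orthPoly] at h ⊢
    field_simp
    linear_combination h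
  | more m ih0 ih1 =>
    intro hm
    have h := hf (m + 1) hm
    have h0 := (hd (m + 1)).ne'
    simp only [motzkinStep, orthPoly] at h ⊢
    rw [sub_mul, mul_assoc, ← ih0 (by omega), ← ih1 (by omega)]
    field_simp
    linear_combination h

theorem Admissible.abs_node_le {x : ℝ} (h : Admissible d σ) (hx : |x - 2 * σ| ≤ 2) : |x| ≤ 2 + 2 * σ := by
  have h1 := abs_le.mp hx
  have h2 := h.sigma_pos
  exact abs_le.mpr ⟨by linarith, by linarith⟩

/-- On `[2σ - 2, 2σ + 2]` the orthogonal polynomials grow at most linearly in the degree. -/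
theorem Admissible.exists_orthPoly_bound (h : Admissible d σ) :
    ∃ C, 0 < C ∧ ∀ x, |x - 2 * σ| ≤ 2 → ∀ n : ℕ, |orthPoly d σ x n| ≤ C * (n + 1) := by
  -- The recurrence is treated as a perturbation of the one with d = 1. In e n, the 4 bounds |x| and
  -- the factor n+1 anticipates linear growth; B n below accumulates the errors and is bounded by
  -- the exponential of their sum.
  set e : ℕ → ℝ := fun n => 4 * ((n + 1) * ((d n)⁻¹ - 1)) with he
  have hd : ∀ n, 0 ≤ (d n)⁻¹ - 1 := fun n =>
    sub_nonneg.mpr ((one_le_inv₀ (h.pos n)).mpr (h.le_one n))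
  have he0 : ∀ n, 0 ≤ e n := fun n => by
    have := hd n
    positivity
  have hes : Summable e := h.summable.mul_left 4
  set B : ℕ → ℝ := fun n => ∏ k ∈ Finset.range n, (1 + e k) with hB
  have hBs : ∀ n, B (n + 1) = B n * (1 + e n) := fun n => Finset.prod_range_succ _ _
  have hB1 : ∀ n, 0 < B n := fun n => Finset.prod_pos fun k _ => by linarith [he0 k]
  have hBmono : ∀ n, B n ≤ B (n + 1) := fun n => by
    rw [hBs]; exact le_mul_of_one_le_right (hB1 n).le (by linarith [he0 n])
  have hBC : ∀ n, B n ≤ Real.exp (∑' k, e k) := fun n =>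
    calc B n ≤ ∏ k ∈ Finset.range n, Real.exp (e k) :=
          Finset.prod_le_prod (fun k _ => by linarith [he0 k])
            fun k _ => by linarith [Real.add_one_le_exp (e k)]
      _ = Real.exp (∑ k ∈ Finset.range n, e k) := (Real.exp_sum _ _).symm
      _ ≤ _ := Real.exp_le_exp.mpr (hes.sum_le_tsum _ fun k _ => he0 k)
  refine ⟨Real.exp (∑' k, e k), Real.exp_pos _, fun x hx => ?_⟩
  have hx4 : |x| ≤ 4 := (h.abs_node_le hx).trans (by linarith [h.sigma_le_one])
  -- With z on the unit circle and z + z̄ = x - 2σ, the unperturbed recurrence factors: p_{n+1} - z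
  -- p_n is z̄ times p_n - z p_{n-1}.
  obtain ⟨z, hz, hzz⟩ : ∃ z : ℂ, ‖z‖ = 1 ∧ z + (starRingEnd ℂ) z = ((x - 2 * σ : ℝ) : ℂ) := by
    refine ⟨⟨(x - 2 * σ) / 2, √(1 - ((x - 2 * σ) / 2) ^ 2)⟩, ?_, ?_⟩
    · have h1 := abs_le.mp hx
      rw [← sq_eq_sq₀ (norm_nonneg _) zero_le_one, Complex.sq_norm, Complex.normSq_mk,
        Real.mul_self_sqrt (by nlinarith)]
      ring
    · apply Complex.ext
      · simp
      · simp
  have hzc : z * (starRingEnd ℂ) z = 1 := by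
    rw [Complex.mul_conj, Complex.normSq_eq_norm_sq, hz]; simp
  have hstep : ∀ n, x / d n - 2 * σ = (x - 2 * σ) + x * ((d n)⁻¹ - 1) := fun n => by
    rw [div_eq_mul_inv]; ring
  have herr : ∀ (n : ℕ) (p b : ℝ), |p| ≤ (n + 1) * b → |x * ((d n)⁻¹ - 1) * p| ≤ b * e n := by
    intro n p b hp
    rw [abs_mul, abs_mul, abs_of_nonneg (hd n)]
    calc |x| * ((d n)⁻¹ - 1) * |p| ≤ 4 * ((d n)⁻¹ - 1) * ((n + 1) * b) :=
          mul_le_mul (mul_le_mul_of_nonneg_right hx4 (hd n)) hp (abs_nonneg _)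
            (mul_nonneg (by norm_num) (hd n))
      _ = b * e n := by rw [he]; ring
  -- The differences p_{n+1} - z p_n stay bounded because |z| = 1; summing them gives linear growth
  -- of p_n.
  have key : ∀ n : ℕ, |orthPoly d σ x n| ≤ (n + 1) * B n ∧
      ‖((orthPoly d σ x (n + 1) : ℝ) : ℂ) - z * (orthPoly d σ x n : ℝ)‖ ≤ B (n + 1) := by
    intro n
    induction n with
    | zero =>
      have h0 : |orthPoly d σ x 0| ≤ ((0 : ℕ) + 1) * B 0 := by simp [orthPoly, hB]
      refine ⟨h0, ?_⟩
      have h1 : ((orthPoly d σ x (0 + 1) : ℝ) : ℂ) - z * (orthPoly d σ x 0 : ℝ) =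
          (starRingEnd ℂ) z + ((x * ((d 0)⁻¹ - 1) * orthPoly d σ x 0 : ℝ) : ℂ) := by
        simp only [orthPoly, hstep]
        push_cast at hzz ⊢
        linear_combination -hzz
      rw [h1, hBs, mul_add, mul_one]
      refine (norm_add_le _ _).trans (add_le_add ?_ ?_)
      · simp [hz, hB]
      · rw [Complex.norm_real]; exact herr 0 _ _ h0
    | succ n ih =>
      obtain ⟨ih0, ih1⟩ := ih
      have h0 : |orthPoly d σ x (n + 1)| ≤ ((n + 1 : ℕ) + 1) * B (n + 1) := by
        have h1 : ‖((orthPoly d σ x (n + 1) : ℝ) : ℂ)‖ ≤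
            B (n + 1) + ‖z * (orthPoly d σ x n : ℝ)‖ :=
          (norm_le_norm_sub_add _ (z * (orthPoly d σ x n : ℝ))).trans
            (add_le_add_left ih1 _)
        rw [norm_mul, hz, one_mul, Complex.norm_real, Complex.norm_real, Real.norm_eq_abs,
          Real.norm_eq_abs] at h1
        have h2 : ((n : ℝ) + 1) * B n ≤ (n + 1) * B (n + 1) :=
          mul_le_mul_of_nonneg_left (hBmono n) (by positivity)
        push_cast
        linarith
      refine ⟨h0, ?_⟩
      have h1 : ((orthPoly d σ x (n + 1 + 1) : ℝ) : ℂ) - z * (orthPoly d σ x (n + 1) : ℝ) =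
          (starRingEnd ℂ) z * ((orthPoly d σ x (n + 1) : ℝ) - z * (orthPoly d σ x n : ℝ)) +
          ((x * ((d (n + 1))⁻¹ - 1) * orthPoly d σ x (n + 1) : ℝ) : ℂ) := by
        rw [orthPoly, hstep]
        push_cast at hzz ⊢
        linear_combination -(orthPoly d σ x (n + 1) : ℂ) * hzz + (orthPoly d σ x n : ℂ) * hzc
      rw [h1, hBs (n + 1), mul_add, mul_one]
      refine (norm_add_le _ _).trans (add_le_add ?_ ?_)
      · rw [norm_mul, RCLike.norm_conj, hz, one_mul]; exact ih1
      · rw [Complex.norm_real]; exact herr (n + 1) _ _ h0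
  intro n
  refine (key n).1.trans ?_
  rw [mul_comm]
  exact mul_le_mul_of_nonneg_right (hBC n) (by positivity)

end

section

variable {d : ℕ → ℝ} {σ x : ℝ}

/-! # A quadrature formula for the path kernel -/

/-- The weight of a step from `m` to `n`: `1` for up and down steps, `c` for horizontal steps. -/
def stepWeight {R : Type*} [Semiring R] (c : R) (m n : ℕ) : R :=
  if n = m then c else if n = m + 1 ∨ m = n + 1 then 1 else 0

theorem stepWeight_comm {R : Type*} [Semiring R] (c : R) (m n : ℕ) :
    stepWeight c m n = stepWeight c n m := by
  unfold stepWeight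
  split_ifs <;> first | rfl | omega

theorem stepWeight_eq_add {R : Type*} [Semiring R] (c : R) (m n : ℕ) :
    stepWeight c m n = (if n = m + 1 then 1 else 0) + (if n = m then c else 0) +
      if m = n + 1 then 1 else 0 := by
  unfold stepWeight
  split_ifs <;> first | omega | simp

theorem sum_stepWeight_mul {R : Type*} [Semiring R] (c : R) {f : ℕ → R} {N m : ℕ}
    (hf : ∀ n, N ≤ n → f n = 0) (hm : m < N) :
    ∑ n ∈ Finset.range N, stepWeight c m n * f n = motzkinStep c f m := by
  have h1 : ∑ n ∈ Finset.range N, (if n = m + 1 then 1 else 0) * f n = f (m + 1) := by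
    simp only [ite_mul, one_mul, zero_mul, Finset.sum_ite_eq', Finset.mem_range]
    split_ifs with h
    · rfl
    · exact (hf _ (not_lt.mp h)).symm
  simp only [stepWeight_eq_add, add_mul, Finset.sum_add_distrib, h1]
  rcases m with _ | m
  · simp [motzkinStep, ite_mul, hm]
  · simp [motzkinStep, ite_mul, hm, (Nat.lt_succ_self m).trans hm, eq_comm (a := m)]

theorem abs_motzkinStep_sub_le {f : ℕ → ℝ} {M : ℝ} (hf : ∀ n, |f n| ≤ M) (c : ℝ) (m : ℕ) :
    |motzkinStep c f m - c * f m| ≤ 2 * M := by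
  rcases m with _ | m
  · have := abs_le.mp (hf 1)
    have := abs_le.mp (hf 0)
    simp only [motzkinStep]
    exact abs_le.mpr ⟨by linarith, by linarith⟩
  · have := abs_le.mp (hf (m + 2))
    have := abs_le.mp (hf m)
    simp only [motzkinStep]
    exact abs_le.mpr ⟨by linarith, by linarith⟩

/-- Eigenvalues of the truncated weighted Motzkin operator lie in `[2σ - 2, 2σ + 2]`. -/
theorem Admissible.abs_eigenvalue_sub_le (h : Admissible d σ) {f : ℕ → ℝ} {N : ℕ}
    (hf0 : ∀ n, N ≤ n → f n = 0) (hf : ∀ m < N, d m * motzkinStep (2 * σ) f m = x * f m)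
    (hne : ∃ m, f m ≠ 0) : |x - 2 * σ| ≤ 2 := by
  obtain ⟨m₁, hm₁⟩ := hne
  have hm₁N : m₁ < N := by
    by_contra hc
    exact hm₁ (hf0 _ (not_lt.mp hc))
  -- Gershgorin's argument: the eigenvalue equation is read where |f| is maximal.
  obtain ⟨m, hm, hmax⟩ := Finset.exists_max_image (Finset.range N) (fun n => |f n|)
    ⟨m₁, Finset.mem_range.mpr hm₁N⟩
  have hM : ∀ n, |f n| ≤ |f m| := fun n => by
    rcases lt_or_ge n N with hn | hn
    · exact hmax n (Finset.mem_range.mpr hn)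
    · rw [hf0 n hn, abs_zero]; exact abs_nonneg _
  have hpos : 0 < |f m| := (abs_pos.mpr hm₁).trans_le (hM m₁)
  have h1 := abs_motzkinStep_sub_le hM (2 * σ) m
  have h2 : (x - 2 * σ * d m) * f m =
      d m * (motzkinStep (2 * σ) f m - 2 * σ * f m) := by
    linear_combination -hf m (Finset.mem_range.mp hm)
  have h3 : |x - 2 * σ * d m| * |f m| ≤ (2 * d m) * |f m| := by
    rw [← abs_mul, h2, abs_mul, abs_of_pos (h.pos m)]
    nlinarith [h.pos m]
  -- This places x between (2σ-2)d_m and (2σ+2)d_m; since 0 < d_m ≤ 1 and 0 < σ ≤ 1, the interval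
  -- for d_m = 1 contains it.
  have h4 := abs_le.mp (le_of_mul_le_mul_right h3 hpos)
  have := h.pos m
  have := h.le_one m
  have := h.sigma_pos
  have := h.sigma_le_one
  exact abs_le.mpr ⟨by nlinarith, by nlinarith⟩

/-- Finite quadrature formulas for the orthogonal polynomials. -/
theorem Admissible.exists_quadrature (h : Admissible d σ) (N : ℕ) :
    ∃ x w : Fin (N + 1) → ℝ, (∀ i, 0 ≤ w i) ∧ (∀ i, |x i - 2 * σ| ≤ 2) ∧
      ∀ m ≤ N, ∀ n ≤ N, ∑ i, w i * (orthPoly d σ (x i) m * orthPoly d σ (x i) n) =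
        if m = n then d m else 0 := by
  -- Conjugation by √d makes the truncated operator symmetric.
  set S : Matrix (Fin (N + 1)) (Fin (N + 1)) ℝ :=
    Matrix.of fun m n => √(d m) * stepWeight (2 * σ) m n * √(d n) with hSdef
  have hS : S.IsHermitian := by
    ext m n
    simp only [hSdef, Matrix.conjTranspose_apply, Matrix.of_apply, star_trivial]
    rw [stepWeight_comm]; ring
  set v : Fin (N + 1) → Fin (N + 1) → ℝ := fun i m => hS.eigenvectorBasis i m with hv
  -- Undoing the conjugation gives eigenvectors of the original operator; extended by 0, they
  -- satisfy its equation at the last site N as well.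
  set W : Fin (N + 1) → ℕ → ℝ := fun i m =>
    if hm : m < N + 1 then √(d m) * v i ⟨m, hm⟩ else 0 with hW
  have hWfin : ∀ i (m : Fin (N + 1)), W i m = √(d m) * v i m := fun i m => dif_pos m.2
  have hW0 : ∀ i m, N + 1 ≤ m → W i m = 0 := fun i m hm => dif_neg (not_lt.mpr hm)
  have hWeig : ∀ i, ∀ m < N + 1, d m * motzkinStep (2 * σ) (W i) m = hS.eigenvalues i * W i m := by
    intro i m hm
    have h1 := congrFun (hS.mulVec_eigenvectorBasis i) ⟨m, hm⟩
    simp only [Matrix.mulVec, dotProduct, hSdef, Matrix.of_apply, Pi.smul_apply, smul_eq_mul] at h1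
    rw [← sum_stepWeight_mul _ (hW0 i) hm, ← Fin.sum_univ_eq_sum_range
      (fun n => stepWeight (2 * σ) m n * W i n), ← Real.mul_self_sqrt (h.pos m).le, mul_assoc,
      Finset.mul_sum]
    have h2 := hWfin i ⟨m, hm⟩
    simp only at h2
    rw [h2, mul_left_comm (hS.eigenvalues i)]
    congr 1
    rw [hv]
    simp only
    rw [← h1]
    refine Finset.sum_congr rfl fun n _ => ?_
    rw [hWfin]; ring
  have hsq : ∀ m, √(d m) ≠ 0 := fun m => (Real.sqrt_pos.mpr (h.pos m)).ne'
  have hWne : ∀ i, ∃ m, W i m ≠ 0 := by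
    intro i
    by_contra! hc
    refine hS.eigenvectorBasis.orthonormal.ne_zero i ?_
    ext m
    have h1 := hc m
    rw [hWfin] at h1
    exact (mul_eq_zero.mp h1).resolve_left (hsq m)
  -- Each W i equals W i 0 times the orthogonal polynomials at the eigenvalue, so orthonormality of
  -- the rows of the eigenvector matrix is the quadrature formula with weights (W i 0)².
  refine ⟨hS.eigenvalues, fun i => W i 0 ^ 2, fun i => sq_nonneg _,
    fun i => h.abs_eigenvalue_sub_le (hW0 i) (hWeig i) (hWne i), fun m hm n hn => ?_⟩
  have hpoly : ∀ i, ∀ k ≤ N, W i k = orthPoly d σ (hS.eigenvalues i) k * W i 0 := fun i =>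
    eq_orthPoly_mul h.pos fun k hk => hWeig i k (hk.trans (Nat.lt_succ_self N))
  have hUU := congrFun (congrFun (Unitary.coe_mul_star_self hS.eigenvectorUnitary)
    ⟨m, Nat.lt_succ_of_le hm⟩) ⟨n, Nat.lt_succ_of_le hn⟩
  rw [Matrix.mul_apply] at hUU
  simp only [Unitary.coe_star, Matrix.star_apply, Matrix.IsHermitian.eigenvectorUnitary_apply,
    star_trivial, Matrix.one_apply, Fin.mk.injEq] at hUU
  calc ∑ i, W i 0 ^ 2 * (orthPoly d σ (hS.eigenvalues i) m * orthPoly d σ (hS.eigenvalues i) n)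
      = ∑ i, √(d m) * √(d n) *
          (v i ⟨m, Nat.lt_succ_of_le hm⟩ * v i ⟨n, Nat.lt_succ_of_le hn⟩) := by
        refine Finset.sum_congr rfl fun i _ => ?_
        have h1 := hpoly i m hm
        have h2 := hpoly i n hn
        have h3 := hWfin i ⟨m, Nat.lt_succ_of_le hm⟩
        have h4 := hWfin i ⟨n, Nat.lt_succ_of_le hn⟩
        simp only at h3 h4
        calc _ = W i m * W i n := by rw [h1, h2]; ring
          _ = _ := by rw [h3, h4]; ring
    _ = _ := by
        rw [← Finset.mul_sum, hv, hUU]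
        split_ifs with hmn
        · rw [hmn, mul_one, Real.mul_self_sqrt (h.pos n).le]
        · rw [mul_zero]

/-- The total weight of the Motzkin paths of length `L` from `m` to `n`, where each visit of `k`
has weight `d k` and each horizontal step has weight `c`. -/
def pathKernel {R : Type*} [Semiring R] (d : ℕ → R) (c : R) : ℕ → ℕ → ℕ → R
  | 0, m, n => if m = n then d m else 0
  | L + 1, m, n => d m * motzkinStep c (fun k => pathKernel d c L k n) m

theorem motzkinStep_sum {R ι : Type*} [CommSemiring R] (c : R) (t : Finset ι) (u : ι → R)
    (f : ι → ℕ → R) (m : ℕ) :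
    motzkinStep c (fun k => ∑ i ∈ t, u i * f i k) m = ∑ i ∈ t, u i * motzkinStep c (f i) m := by
  rcases m with _ | m
  · simp only [motzkinStep, Finset.mul_sum, ← Finset.sum_add_distrib]
    exact Finset.sum_congr rfl fun i _ => by ring
  · simp only [motzkinStep, Finset.mul_sum, ← Finset.sum_add_distrib]
    exact Finset.sum_congr rfl fun i _ => by ring

theorem motzkinStep_congr {R : Type*} [Semiring R] (c : R) {f g : ℕ → R} {m : ℕ}
    (h : ∀ k ≤ m + 1, f k = g k) : motzkinStep c f m = motzkinStep c g m := by
  rcases m with _ | m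
  · simp only [motzkinStep, h 0 (by omega), h 1 (by omega)]
  · simp only [motzkinStep, h (m + 2) (by omega), h (m + 1) (by omega), h m (by omega)]

theorem mul_le_motzkinStep {c : ℝ} {f : ℕ → ℝ} (hf : ∀ k, 0 ≤ f k) (m : ℕ) :
    c * f m ≤ motzkinStep c f m := by
  rcases m with _ | m
  · simp only [motzkinStep]; linarith [hf 1]
  · simp only [motzkinStep]; linarith [hf (m + 2), hf m]

theorem Admissible.pathKernel_nonneg (h : Admissible d σ) :
    ∀ L m n, 0 ≤ pathKernel d (2 * σ) L m n := by
  intro L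
  induction L with
  | zero => intro m n; rw [pathKernel]; split_ifs; exacts [(h.pos m).le, le_rfl]
  | succ L ih =>
    intro m n
    have hσ : 0 ≤ 2 * σ := by linarith [h.sigma_pos]
    exact mul_nonneg (h.pos m).le
      ((mul_nonneg hσ (ih m n)).trans (mul_le_motzkinStep (fun k => ih k n) m))

/-- Paths of length L from m never climb above m+L ≤ N, so they do not see the truncation; each step
multiplies the i-th term by x i. -/
theorem Admissible.pathKernel_eq_sum (h : Admissible d σ) {N : ℕ} {x w : Fin (N + 1) → ℝ}
    (hq : ∀ m ≤ N, ∀ n ≤ N, ∑ i, w i * (orthPoly d σ (x i) m * orthPoly d σ (x i) n) =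
      if m = n then d m else 0) :
    ∀ L m n, m + L ≤ N → n ≤ N → pathKernel d (2 * σ) L m n =
      ∑ i, w i * x i ^ L * orthPoly d σ (x i) n * orthPoly d σ (x i) m := by
  intro L
  induction L with
  | zero =>
    intro m n hm hn
    rw [pathKernel, ← hq m hm n hn]
    exact Finset.sum_congr rfl fun i _ => by ring
  | succ L ih =>
    intro m n hm hn
    rw [pathKernel, motzkinStep_congr _ (fun k hk => ih k n (by omega) hn), motzkinStep_sum,
      Finset.mul_sum]
    refine Finset.sum_congr rfl fun i _ => ?_
    rw [mul_left_comm, mul_motzkinStep_orthPoly h.pos]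
    ring

theorem Admissible.pathKernel_comm (h : Admissible d σ) (L m n : ℕ) :
    pathKernel d (2 * σ) L m n = pathKernel d (2 * σ) L n m := by
  obtain ⟨x, w, -, -, hq⟩ := h.exists_quadrature (m + n + L)
  rw [h.pathKernel_eq_sum hq L m n (by omega) (by omega),
    h.pathKernel_eq_sum hq L n m (by omega) (by omega)]
  exact Finset.sum_congr rfl fun i _ => by ring

theorem Admissible.pathKernel_zero_pos (h : Admissible d σ) (L : ℕ) :
    0 < pathKernel d (2 * σ) L 0 0 := by
  induction L with
  | zero => simpa [pathKernel] using h.pos 0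
  | succ L ih =>
    have hσ : 0 < 2 * σ := by linarith [h.sigma_pos]
    exact mul_pos (h.pos 0) ((mul_pos hσ ih).trans_le
      (mul_le_motzkinStep (fun k => h.pathKernel_nonneg L k 0) 0))

/-- Prepending a horizontal step at altitude 0 makes odd and even lengths comparable; here σ > 0 is
essential. -/
theorem Admissible.mul_pathKernel_zero_le (h : Admissible d σ) (L : ℕ) :
    d 0 * (2 * σ) * pathKernel d (2 * σ) L 0 0 ≤ pathKernel d (2 * σ) (L + 1) 0 0 := by
  have hσ : 0 < 2 * σ := by linarith [h.sigma_pos]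
  rw [mul_assoc]
  exact mul_le_mul_of_nonneg_left
      (mul_le_motzkinStep (fun k => h.pathKernel_nonneg L k 0) 0) (h.pos 0).le

/-- The absolute moments of the quadrature measures are comparable with the weight of the
excursions. -/
theorem Admissible.exists_sum_abs_pow_le (h : Admissible d σ) :
    ∃ C, 0 < C ∧ ∀ (N : ℕ) (x w : Fin (N + 1) → ℝ), (∀ i, 0 ≤ w i) →
      (∀ i, |x i - 2 * σ| ≤ 2) →
      (∀ m ≤ N, ∀ n ≤ N, ∑ i, w i * (orthPoly d σ (x i) m * orthPoly d σ (x i) n) =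
        if m = n then d m else 0) →
      ∀ L ≤ N, ∑ i, w i * |x i| ^ L ≤ C * pathKernel d (2 * σ) L 0 0 := by
  have hσ := h.sigma_pos
  have hd := h.pos 0
  refine ⟨1 + 4 / (d 0 * (2 * σ)), by positivity, fun N x w hw hx hq L hL => ?_⟩
  -- Even absolute moments are plain moments, hence kernel values; an odd one is compared with the
  -- even one just below, using |x| ≤ 4.
  have hev : ∀ K ≤ N, Even K → ∑ i, w i * |x i| ^ K = pathKernel d (2 * σ) K 0 0 := by
    intro K hK hKe
    rw [h.pathKernel_eq_sum hq K 0 0 (by omega) (by omega)]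
    exact Finset.sum_congr rfl fun i _ => by rw [hKe.pow_abs]; simp [orthPoly]
  rcases Nat.even_or_odd L with hLe | ⟨k, rfl⟩
  · rw [hev L hL hLe]
    exact le_mul_of_one_le_left (h.pathKernel_zero_pos L).le
      (le_add_of_nonneg_right (by positivity))
  · have h1 : ∑ i, w i * |x i| ^ (2 * k + 1) ≤ 4 * ∑ i, w i * |x i| ^ (2 * k) := by
      rw [Finset.mul_sum]
      refine Finset.sum_le_sum fun i _ => ?_
      have hx4 : |x i| ≤ 4 := (h.abs_node_le (hx i)).trans (by linarith [h.sigma_le_one])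
      rw [pow_succ]
      have := mul_nonneg (hw i) (pow_nonneg (abs_nonneg (x i)) (2 * k))
      nlinarith
    rw [hev _ (by omega) (even_two_mul k)] at h1
    have h2 := h.mul_pathKernel_zero_le (2 * k)
    have h3 : 4 * pathKernel d (2 * σ) (2 * k) 0 0 ≤
        4 / (d 0 * (2 * σ)) * pathKernel d (2 * σ) (2 * k + 1) 0 0 := by
      rw [div_mul_eq_mul_div, le_div_iff₀ (by positivity)]
      nlinarith
    have h4 := (h.pathKernel_zero_pos (2 * k + 1)).le
    linarith

/-- Linear growth of the polynomials inserted into the quadrature formula. Uniformity in L makes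
this the dominating bound for the sums over endpoints. -/
theorem Admissible.exists_pathKernel_le (h : Admissible d σ) :
    ∃ C, 0 < C ∧ ∀ L m n : ℕ, pathKernel d (2 * σ) L m n ≤
      C * (m + 1) * (n + 1) * pathKernel d (2 * σ) L 0 0 := by
  obtain ⟨C₁, hC₁, hpoly⟩ := h.exists_orthPoly_bound
  obtain ⟨C₂, hC₂, hmom⟩ := h.exists_sum_abs_pow_le
  refine ⟨C₁ * C₁ * C₂, by positivity, fun L m n => ?_⟩
  obtain ⟨x, w, hw, hx, hq⟩ := h.exists_quadrature (m + n + L)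
  rw [h.pathKernel_eq_sum hq L m n (by omega) (by omega)]
  calc ∑ i, w i * x i ^ L * orthPoly d σ (x i) n * orthPoly d σ (x i) m
      ≤ ∑ i, C₁ * (n + 1) * (C₁ * (m + 1)) * (w i * |x i| ^ L) := by
        refine Finset.sum_le_sum fun i _ => (le_abs_self _).trans ?_
        rw [abs_mul, abs_mul, abs_mul, abs_of_nonneg (hw i), abs_pow, mul_assoc, mul_comm]
        exact mul_le_mul_of_nonneg_right (mul_le_mul (hpoly _ (hx i) n) (hpoly _ (hx i) m)
          (abs_nonneg _) (by positivity)) (mul_nonneg (hw i) (by positivity))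
    _ ≤ C₁ * (n + 1) * (C₁ * (m + 1)) * (C₂ * pathKernel d (2 * σ) L 0 0) := by
        rw [← Finset.mul_sum]
        exact mul_le_mul_of_nonneg_left (hmom _ x w hw hx hq L (by omega)) (by positivity)
    _ = _ := by ring

/-- The orthogonal polynomials at `x` form an eigenvector of the path kernel. -/
theorem Admissible.sum_pathKernel_mul_orthPoly (h : Admissible d σ) {N : ℕ} :
    ∀ L m, m + L < N → ∑ n ∈ Finset.range N,
      (orthPoly d σ x n / d n) * pathKernel d (2 * σ) L m n = x ^ L * orthPoly d σ x m := by
  intro L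
  induction L with
  | zero =>
    intro m hm
    have := (h.pos m).ne'
    simp only [pathKernel, mul_ite, mul_zero, Finset.sum_ite_eq, Finset.mem_range]
    rw [if_pos (by omega)]
    field_simp
  | succ L ih =>
    intro m hm
    -- The right-hand side is written as a one-term sum so that `motzkinStep_sum` extracts the
    -- scalar x^L.
    have h1 : motzkinStep (2 * σ) (fun k => ∑ n ∈ Finset.range N,
        (orthPoly d σ x n / d n) * pathKernel d (2 * σ) L k n) m =
        motzkinStep (2 * σ) (fun k => ∑ _i ∈ Finset.range 1, x ^ L * orthPoly d σ x k) m :=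
      motzkinStep_congr _ fun k _ => by rw [ih k (by omega)]; simp
    rw [motzkinStep_sum, motzkinStep_sum] at h1
    simp only [Finset.sum_range_one] at h1
    simp only [pathKernel, mul_left_comm _ (d m)]
    rw [← Finset.mul_sum, h1, mul_left_comm, mul_motzkinStep_orthPoly h.pos]
    ring

/-- The eigenvector identity at the upper edge writes Λ^L as a sum of L+1 terms p_n(Λ)/d_n ·
K_L(0,n). Both factors are at most linear in n, the second relative to K_L(0,0), whence the cube. -/
theorem Admissible.exists_pow_le_pathKernel (h : Admissible d σ) :
    ∃ C, 0 < C ∧ ∀ L : ℕ, (2 + 2 * σ) ^ L ≤ C * (L + 1) ^ 3 * pathKernel d (2 * σ) L 0 0 := by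
  obtain ⟨C₁, hC₁, hpoly⟩ := h.exists_orthPoly_bound
  obtain ⟨C₂, hC₂, hker⟩ := h.exists_pathKernel_le
  have hband : |2 + 2 * σ - 2 * σ| ≤ 2 := by rw [add_sub_cancel_right]; simp
  set T := ∑' n : ℕ, (n + 1 : ℝ) * ((d n)⁻¹ - 1) with hT
  have hd : ∀ n, 0 ≤ (d n)⁻¹ - 1 := fun n =>
    sub_nonneg.mpr ((one_le_inv₀ (h.pos n)).mpr (h.le_one n))
  have hterm : ∀ n : ℕ, 0 ≤ ((n : ℝ) + 1) * ((d n)⁻¹ - 1) := fun n =>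
    mul_nonneg (by positivity) (hd n)
  have hT0 : 0 ≤ T := tsum_nonneg hterm
  have hinv : ∀ n, (d n)⁻¹ ≤ 1 + T := fun n => by
    have h1 : ((n : ℝ) + 1) * ((d n)⁻¹ - 1) ≤ T := h.summable.le_tsum n fun k _ => hterm k
    have h2 : (0 : ℝ) ≤ n := n.cast_nonneg
    nlinarith [hd n, mul_nonneg h2 (hd n)]
  refine ⟨C₁ * (1 + T) * C₂, by positivity, fun L => ?_⟩
  have ha := (h.pathKernel_zero_pos L).le
  calc (2 + 2 * σ) ^ L = ∑ n ∈ Finset.range (L + 1),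
        (orthPoly d σ (2 + 2 * σ) n / d n) * pathKernel d (2 * σ) L 0 n := by
        rw [h.sum_pathKernel_mul_orthPoly L 0 (by omega)]; simp [orthPoly]
    _ ≤ ∑ n ∈ Finset.range (L + 1), C₁ * (1 + T) * C₂ * (L + 1) ^ 2 *
          pathKernel d (2 * σ) L 0 0 := by
        refine Finset.sum_le_sum fun n hn => ?_
        have hn' : (n : ℝ) + 1 ≤ L + 1 := by
          exact_mod_cast Nat.succ_le_of_lt (Finset.mem_range.mp hn)
        have h1 : orthPoly d σ (2 + 2 * σ) n / d n ≤ C₁ * (L + 1) * (1 + T) := by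
          rw [div_eq_mul_inv]
          refine mul_le_mul (((le_abs_self _).trans (hpoly _ hband n)).trans ?_) (hinv n)
            (inv_nonneg.mpr (h.pos n).le) (by positivity)
          exact mul_le_mul_of_nonneg_left hn' hC₁.le
        have h2 : pathKernel d (2 * σ) L 0 n ≤ C₂ * (L + 1) * pathKernel d (2 * σ) L 0 0 := by
          refine (hker L 0 n).trans (mul_le_mul_of_nonneg_right ?_ ha)
          simpa using mul_le_mul_of_nonneg_left hn' hC₂.le
        calc _ ≤ C₁ * (L + 1) * (1 + T) * (C₂ * (L + 1) * pathKernel d (2 * σ) L 0 0) :=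
              mul_le_mul h1 h2 (h.pathKernel_nonneg L 0 n) (by positivity)
          _ = _ := by ring
    _ = _ := by
        rw [Finset.sum_const, Finset.card_range, nsmul_eq_mul]
        push_cast
        ring

end

section

variable {d : ℕ → ℝ} {σ x : ℝ}

/-! # Ratio limits of the path kernel -/

theorem Admissible.tendsto_pow_div_pathKernel (h : Admissible d σ) {r : ℝ} (hr : 0 ≤ r)
    (hr' : r < 2 + 2 * σ) :
    Tendsto (fun L : ℕ => r ^ L / pathKernel d (2 * σ) L 0 0) atTop (𝓝 0) := by
  obtain ⟨C, hC, hlow⟩ := h.exists_pow_le_pathKernel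
  have hΛ : 0 < 2 + 2 * σ := hr.trans_lt hr'
  -- The exponent is raised to L+1 to match the base of the cube, at the cost of a factor Λ/r; the
  -- case r = 0 is therefore separate.
  have hlim : Tendsto (fun L : ℕ => C * (2 + 2 * σ) / r *
      (((L + 1 : ℕ) : ℝ) ^ 3 * (r / (2 + 2 * σ)) ^ (L + 1))) atTop (𝓝 (C * (2 + 2 * σ) / r * 0)) :=
    ((tendsto_add_atTop_iff_nat 1).mpr (tendsto_pow_const_mul_const_pow_of_lt_one 3
      (div_nonneg hr hΛ.le) ((div_lt_one hΛ).mpr hr'))).const_mul _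
  rcases hr.eq_or_lt with rfl | hr0
  · refine tendsto_const_nhds.congr' ?_
    filter_upwards [eventually_ge_atTop 1] with L hL
    rw [zero_pow (by omega), zero_div]
  rw [mul_zero] at hlim
  refine squeeze_zero (fun L => div_nonneg (pow_nonneg hr L) (h.pathKernel_zero_pos L).le)
    (fun L => ?_) hlim
  rw [div_le_iff₀ (h.pathKernel_zero_pos L)]
  have h1 := mul_le_mul_of_nonneg_left (hlow L) (pow_nonneg (div_nonneg hr hΛ.le) L)
  rw [div_pow, div_mul_cancel₀ _ (pow_pos hΛ L).ne', ← div_pow] at h1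
  refine h1.trans_eq ?_
  push_cast
  have hne : 1 + σ ≠ 0 := by linarith
  rw [pow_succ _ L]
  field_simp

/-- In the quadrature formula for K_{L+1} - ΛK_L, nodes within δ of Λ contribute at most δ times the
absolute moment, and all others O(r^L) with r < Λ. -/
theorem Admissible.tendsto_pathKernel_ratio (h : Admissible d σ) :
    Tendsto (fun L => pathKernel d (2 * σ) (L + 1) 0 0 / pathKernel d (2 * σ) L 0 0) atTop
      (𝓝 (2 + 2 * σ)) := by
  obtain ⟨C, hC, hmom⟩ := h.exists_sum_abs_pow_le
  have hσ := h.sigma_pos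
  have hσ1 := h.sigma_le_one
  have hpos := h.pathKernel_zero_pos
  rw [Metric.tendsto_atTop]
  intro ε hε
  set δ := ε / (2 * C) with hδ
  have hδ0 : 0 < δ := by positivity
  -- A node below Λ-δ is still at least 2σ-2, so r bounds its modulus; r < Λ since σ > 0 rules out a
  -- competing negative edge.
  set r := max (2 + 2 * σ - δ) (2 - 2 * σ) with hr
  have hr0 : 0 ≤ r := le_max_of_le_right (by linarith)
  have hrΛ : r < 2 + 2 * σ := max_lt (by linarith) (by linarith)
  have hest : ∀ L, |pathKernel d (2 * σ) (L + 1) 0 0 - (2 + 2 * σ) * pathKernel d (2 * σ) L 0 0| ≤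
      δ * (C * pathKernel d (2 * σ) L 0 0) + 8 * d 0 * r ^ L := by
    intro L
    obtain ⟨x, w, hw, hx, hq⟩ := h.exists_quadrature (L + 1)
    have hmass : ∑ i, w i = d 0 := by simpa [orthPoly] using hq 0 (by omega) 0 (by omega)
    have h0 := h.pathKernel_eq_sum hq L 0 0 (by omega) (by omega)
    have h1 := h.pathKernel_eq_sum hq (L + 1) 0 0 (by omega) (by omega)
    simp only [orthPoly, mul_one] at h0 h1
    rw [h1, h0, Finset.mul_sum, ← Finset.sum_sub_distrib]
    calc |∑ i, (w i * x i ^ (L + 1) - (2 + 2 * σ) * (w i * x i ^ L))|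
        ≤ ∑ i, |w i * x i ^ (L + 1) - (2 + 2 * σ) * (w i * x i ^ L)| :=
          Finset.abs_sum_le_sum_abs _ _
      _ ≤ ∑ i, (δ * (w i * |x i| ^ L) + 8 * r ^ L * w i) := by
          refine Finset.sum_le_sum fun i _ => ?_
          have hxi := abs_le.mp (hx i)
          rw [show w i * x i ^ (L + 1) - (2 + 2 * σ) * (w i * x i ^ L) =
            w i * (x i ^ L * (x i - (2 + 2 * σ))) by ring, abs_mul, abs_of_nonneg (hw i), abs_mul,
            abs_pow, abs_of_nonpos (show x i - (2 + 2 * σ) ≤ 0 by linarith)]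
          have hwx : 0 ≤ w i * |x i| ^ L := mul_nonneg (hw i) (by positivity)
          have hwr : 0 ≤ r ^ L * w i := mul_nonneg (by positivity) (hw i)
          rcases le_or_gt (2 + 2 * σ - δ) (x i) with hc | hc
          · nlinarith
          · have h2 : |x i| ≤ r := abs_le.mpr
              ⟨by linarith [le_max_right (2 + 2 * σ - δ) (2 - 2 * σ)],
                hc.le.trans (le_max_left _ _)⟩
            have h3 : w i * |x i| ^ L ≤ r ^ L * w i := by
              rw [mul_comm]
              exact mul_le_mul_of_nonneg_right (pow_le_pow_left₀ (abs_nonneg _) h2 L) (hw i)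
            nlinarith [mul_nonneg hδ0.le hwx]
      _ = δ * ∑ i, w i * |x i| ^ L + 8 * d 0 * r ^ L := by
          rw [Finset.sum_add_distrib, ← Finset.mul_sum, ← Finset.mul_sum, hmass]; ring
      _ ≤ _ := by
        rw [← h0]
        exact add_le_add_left (mul_le_mul_of_nonneg_left (hmom _ x w hw hx hq L (by omega)) hδ0.le) _
  have hsmall := (h.tendsto_pow_div_pathKernel hr0 hrΛ).const_mul (8 * d 0)
  rw [mul_zero] at hsmall
  obtain ⟨N, hN⟩ := eventually_atTop.mp (hsmall.eventually (gt_mem_nhds (half_pos hε)))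
  refine ⟨N, fun L hL => ?_⟩
  have h1 := hN L hL
  rw [Real.dist_eq, div_sub' (hpos L).ne', abs_div, abs_of_pos (hpos L),
    div_lt_iff₀ (hpos L), mul_comm (pathKernel d (2 * σ) L 0 0)]
  refine (hest L).trans_lt ?_
  rw [← mul_div_assoc, div_lt_iff₀ (hpos L)] at h1
  have h2 : δ * (C * pathKernel d (2 * σ) L 0 0) = ε / 2 * pathKernel d (2 * σ) L 0 0 := by
    rw [hδ]; field_simp
  linarith

/-- The recurrence expresses g L (m+1) through g (L+1) m, g L m and g L (m-1); the ratio limit makes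
the time shift a factor Λ. An arbitrary g lets the lemma be used in either variable of the kernel.
-/
theorem Admissible.tendsto_of_tendsto_zero (h : Admissible d σ) {g : ℕ → ℕ → ℝ} {l : ℝ}
    (hg : ∀ L m, g (L + 1) m = d m * motzkinStep (2 * σ) (g L) m)
    (h0 : Tendsto (fun L => g L 0 / pathKernel d (2 * σ) L 0 0) atTop (𝓝 l)) (m : ℕ) :
    Tendsto (fun L => g L m / pathKernel d (2 * σ) L 0 0) atTop
      (𝓝 (orthPoly d σ (2 + 2 * σ) m * l)) := by
  have hpos := h.pathKernel_zero_pos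
  have hnext : ∀ {m l}, Tendsto (fun L => g L m / pathKernel d (2 * σ) L 0 0) atTop (𝓝 l) →
      Tendsto (fun L => g (L + 1) m / pathKernel d (2 * σ) L 0 0) atTop
        (𝓝 (l * (2 + 2 * σ))) := fun {m l} hm => by
    refine (((tendsto_add_atTop_iff_nat 1).mpr hm).mul h.tendsto_pathKernel_ratio).congr
      fun L => ?_
    have h1 := (hpos L).ne'
    have h2 := (hpos (L + 1)).ne'
    field_simp
  induction m using Nat.twoStepInduction with
  | zero => simpa [orthPoly] using h0
  | one =>
    have hd := (h.pos 0).ne'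
    have h1 := ((hnext h0).div_const (d 0)).sub (h0.const_mul (2 * σ))
    rw [show orthPoly d σ (2 + 2 * σ) 1 * l = l * (2 + 2 * σ) / d 0 - 2 * σ * l by
      simp only [orthPoly]; ring]
    refine h1.congr fun L => ?_
    rw [hg, motzkinStep]
    field_simp
    ring
  | more m ih0 ih1 =>
    have hd := (h.pos (m + 1)).ne'
    have h1 := (((hnext ih1).div_const (d (m + 1))).sub (ih1.const_mul (2 * σ))).sub ih0
    rw [show orthPoly d σ (2 + 2 * σ) (m + 2) * l =
      orthPoly d σ (2 + 2 * σ) (m + 1) * l * (2 + 2 * σ) / d (m + 1) -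
        2 * σ * (orthPoly d σ (2 + 2 * σ) (m + 1) * l) - orthPoly d σ (2 + 2 * σ) m * l by
      rw [orthPoly]; ring]
    refine h1.congr fun L => ?_
    rw [hg, motzkinStep]
    field_simp
    ring

/-- The **ratio limit theorem** for the path kernel. -/
theorem Admissible.tendsto_pathKernel_div (h : Admissible d σ) (m n : ℕ) :
    Tendsto (fun L => pathKernel d (2 * σ) L m n / pathKernel d (2 * σ) L 0 0) atTop
      (𝓝 (orthPoly d σ (2 + 2 * σ) m * orthPoly d σ (2 + 2 * σ) n)) := by
  -- One variable at a time: first K(·,0), transposed by symmetry, then K(·,n).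
  have h1 := h.tendsto_of_tendsto_zero (g := fun L m => pathKernel d (2 * σ) L m 0) (l := 1)
    (fun L m => rfl)
    (tendsto_const_nhds.congr fun L => (div_self (h.pathKernel_zero_pos L).ne').symm) n
  simp only [mul_one, h.pathKernel_comm _ n 0] at h1
  exact h.tendsto_of_tendsto_zero (g := fun L m => pathKernel d (2 * σ) L m n)
    (fun L m => rfl) h1 m

theorem Admissible.tendsto_pathKernel_add_div (h : Admissible d σ) (m n k : ℕ) :
    Tendsto (fun L => pathKernel d (2 * σ) L m n / pathKernel d (2 * σ) (L + k) 0 0) atTop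
      (𝓝 (orthPoly d σ (2 + 2 * σ) m * orthPoly d σ (2 + 2 * σ) n / (2 + 2 * σ) ^ k)) := by
  induction k with
  | zero => simpa using h.tendsto_pathKernel_div m n
  | succ k ih =>
    have hΛ : 2 + 2 * σ ≠ 0 := by linarith [h.sigma_pos]
    have h1 := ih.div ((tendsto_add_atTop_iff_nat k).mpr h.tendsto_pathKernel_ratio) hΛ
    rw [pow_succ, ← div_div]
    refine h1.congr fun L => ?_
    have h2 := (h.pathKernel_zero_pos (L + k)).ne'
    have h3 := (h.pathKernel_zero_pos (L + k + 1)).ne'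
    simp only [Pi.div_apply, ← add_assoc]
    field_simp

/-- Nonnegativity is inherited from the ratios of kernels. At a first zero the eigenvalue equation
would make the sum of a positive and a nonnegative neighbour vanish. -/
theorem Admissible.orthPoly_pos (h : Admissible d σ) (n : ℕ) :
    0 < orthPoly d σ (2 + 2 * σ) n := by
  have hnn : ∀ n, 0 ≤ orthPoly d σ (2 + 2 * σ) n := fun n => by
    have h1 := h.tendsto_pathKernel_div 0 n
    rw [orthPoly, one_mul] at h1
    exact ge_of_tendsto' h1 fun L =>
      div_nonneg (h.pathKernel_nonneg L 0 n) (h.pathKernel_zero_pos L).le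
  induction n with
  | zero => simp [orthPoly]
  | succ n ih =>
    refine (hnn _).lt_of_ne' fun hz => ?_
    have h1 := mul_motzkinStep_orthPoly (σ := σ) (x := 2 + 2 * σ) h.pos (n + 1)
    rw [motzkinStep, hz] at h1
    have h2 := hnn (n + 2)
    have h3 := h.pos (n + 1)
    nlinarith [mul_pos h3 ih, mul_nonneg h3.le h2]

/-! ### Summation over the endpoints -/

theorem summable_succ_mul_pow {ρ : ℝ} (hρ : 0 ≤ ρ) (hρ' : ρ < 1) :
    Summable fun n : ℕ => ((n : ℝ) + 1) * ρ ^ n := by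
  have hn : ‖ρ‖ < 1 := by rwa [Real.norm_of_nonneg hρ]
  have h1 := summable_pow_mul_geometric_of_norm_lt_one 1 hn
  simp only [pow_one] at h1
  simpa [add_mul] using h1.add (summable_geometric_of_lt_one hρ hρ')

theorem Admissible.summable_pow_mul_pathKernel (h : Admissible d σ) {ρ₀ ρ₁ : ℝ} (hρ₀ : 0 ≤ ρ₀)
    (hρ₀' : ρ₀ < 1) (hρ₁ : 0 ≤ ρ₁) (hρ₁' : ρ₁ < 1) (L : ℕ) :
    Summable fun p : ℕ × ℕ => ρ₀ ^ p.1 * ρ₁ ^ p.2 * pathKernel d (2 * σ) L p.1 p.2 := by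
  obtain ⟨C, hC, hker⟩ := h.exists_pathKernel_le
  have hs := ((summable_succ_mul_pow hρ₀ hρ₀').mul_of_nonneg (summable_succ_mul_pow hρ₁ hρ₁')
    (fun n => by positivity) (fun n => by positivity)).mul_left (C * pathKernel d (2 * σ) L 0 0)
  refine hs.of_nonneg_of_le (fun p => mul_nonneg (by positivity) (h.pathKernel_nonneg L _ _))
    fun p => ?_
  refine (mul_le_mul_of_nonneg_left (hker L p.1 p.2) (by positivity)).trans_eq ?_
  ring

/-- Dominated convergence, with majorant C(m+1)(n+1)ρ₀^m ρ₁^n. -/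
theorem Admissible.tendsto_tsum_pathKernel_div (h : Admissible d σ) {ρ₀ ρ₁ : ℝ} (hρ₀ : 0 ≤ ρ₀)
    (hρ₀' : ρ₀ < 1) (hρ₁ : 0 ≤ ρ₁) (hρ₁' : ρ₁ < 1) :
    Tendsto (fun L => (∑' p : ℕ × ℕ, ρ₀ ^ p.1 * ρ₁ ^ p.2 * pathKernel d (2 * σ) L p.1 p.2) /
      pathKernel d (2 * σ) L 0 0) atTop
      (𝓝 ((∑' n, ρ₀ ^ n * orthPoly d σ (2 + 2 * σ) n) *
        ∑' n, ρ₁ ^ n * orthPoly d σ (2 + 2 * σ) n)) := by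
  obtain ⟨C, hC, hker⟩ := h.exists_pathKernel_le
  obtain ⟨C₁, hC₁, hpoly⟩ := h.exists_orthPoly_bound
  have hband : |2 + 2 * σ - 2 * σ| ≤ 2 := by rw [add_sub_cancel_right]; simp
  have hnn := fun n => (h.orthPoly_pos n).le
  have hsum : ∀ {ρ : ℝ}, 0 ≤ ρ → ρ < 1 →
      Summable fun n => ρ ^ n * orthPoly d σ (2 + 2 * σ) n := fun {ρ} hρ hρ' => by
    refine ((summable_succ_mul_pow hρ hρ').mul_left C₁).of_nonneg_of_le
      (fun n => mul_nonneg (by positivity) (hnn n)) fun n => ?_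
    refine (mul_le_mul_of_nonneg_left ((le_abs_self _).trans (hpoly _ hband n))
      (by positivity)).trans_eq ?_
    ring
  rw [tsum_mul_tsum_of_summable_norm (hsum hρ₀ hρ₀').norm (hsum hρ₁ hρ₁').norm]
  simp only [← tsum_div_const]
  refine tendsto_tsum_of_dominated_convergence
    (((summable_succ_mul_pow hρ₀ hρ₀').mul_of_nonneg (summable_succ_mul_pow hρ₁ hρ₁')
    (fun n => by positivity) (fun n => by positivity)).mul_left C) (fun p => ?_)
    (.of_forall fun L p => ?_)
  · have h1 := (h.tendsto_pathKernel_div p.1 p.2).const_mul (ρ₀ ^ p.1 * ρ₁ ^ p.2)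
    simp only [← mul_div_assoc] at h1
    convert h1 using 2
    ring
  · have ha := h.pathKernel_zero_pos L
    rw [Real.norm_of_nonneg (div_nonneg (mul_nonneg (by positivity) (h.pathKernel_nonneg L _ _))
      ha.le), div_le_iff₀ ha]
    refine (mul_le_mul_of_nonneg_left (hker L p.1 p.2) (by positivity)).trans_eq ?_
    ring

end

section

/-! # Path sums by transfer operators -/

/-- The weight of a sequence of altitudes, for site weights `φ` depending on time. -/
def pathWeight {R : Type*} [CommSemiring R] (c : R) (φ : ℕ → ℕ → R) (L : ℕ)
    (γ : Fin (L + 1) → ℕ) : R :=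
  (∏ k : Fin (L + 1), φ k (γ k)) * ∏ j : Fin L, stepWeight c (γ j.castSucc) (γ j.succ)

/-- The total weight of the paths of length `L` started from `m`. -/
def transfer {R : Type*} [Semiring R] (c : R) : (ℕ → ℕ → R) → ℕ → ℕ → R
  | φ, 0, m => φ 0 m
  | φ, L + 1, m => φ 0 m * motzkinStep c (transfer c (fun k => φ (k + 1)) L) m

theorem tsum_stepWeight_mul (c : ENNReal) (f : ℕ → ENNReal) (m : ℕ) :
    ∑' n, stepWeight c m n * f n = motzkinStep c f m := by
  simp only [stepWeight_eq_add, add_mul, ENNReal.tsum_add, ite_mul, one_mul, zero_mul, tsum_ite_eq]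
  rcases m with _ | m
  · simp [motzkinStep]
  · simp [motzkinStep, eq_comm (a := m)]

theorem pathWeight_cons {R : Type*} [CommSemiring R] (c : R) (φ : ℕ → ℕ → R) (L m : ℕ)
    (γ : Fin (L + 1) → ℕ) :
    pathWeight c φ (L + 1) (Fin.cons m γ) =
      φ 0 m * (stepWeight c m (γ 0) * pathWeight c (fun k => φ (k + 1)) L γ) := by
  have h : ∏ j : Fin (L + 1), stepWeight c ((Fin.cons m γ : Fin (L + 2) → ℕ) j.castSucc)
      ((Fin.cons m γ : Fin (L + 2) → ℕ) j.succ) =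
      stepWeight c m (γ 0) * ∏ j : Fin L, stepWeight c (γ j.castSucc) (γ j.succ) := by
    rw [Fin.prod_univ_succ]
    simp only [Fin.castSucc_zero, ← Fin.succ_castSucc, Fin.cons_zero, Fin.cons_succ]
  rw [pathWeight, pathWeight, h, Fin.prod_univ_succ]
  simp only [Fin.cons_zero, Fin.cons_succ, Fin.val_zero, Fin.val_succ]
  ring

/-- The first altitude is split off. The test function g is kept general because the removed step
becomes a function of the next altitude. -/
theorem tsum_mul_pathWeight (c : ENNReal) (L : ℕ) : ∀ (φ : ℕ → ℕ → ENNReal) (g : ℕ → ENNReal),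
    ∑' γ : Fin (L + 1) → ℕ, g (γ 0) * pathWeight c φ L γ = ∑' m, g m * transfer c φ L m := by
  induction L with
  | zero =>
    intro φ g
    rw [← (Equiv.funUnique (Fin 1) ℕ).symm.tsum_eq]
    simp [pathWeight, transfer]
  | succ L ih =>
    intro φ g
    rw [← (Fin.consEquiv fun _ : Fin (L + 2) => ℕ).tsum_eq, ENNReal.tsum_prod']
    refine tsum_congr fun m => ?_
    simp only [Fin.consEquiv, Equiv.coe_fn_mk, Fin.cons_zero, pathWeight_cons, transfer,
      ENNReal.tsum_mul_left]
    rw [ih, tsum_stepWeight_mul]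

theorem motzkinStep_single {R : Type*} [Semiring R] (c V : R) (z m : ℕ) :
    motzkinStep c (fun n => if n = z then V else 0) m = stepWeight c m z * V := by
  rw [stepWeight_eq_add, add_mul, add_mul]
  rcases m with _ | m
  · simp [motzkinStep, eq_comm (a := z)]
  · simp [motzkinStep, eq_comm (a := z)]

theorem motzkinStep_mul_right {R : Type*} [CommSemiring R] (c V : R) (f : ℕ → R) (m : ℕ) :
    motzkinStep c (fun n => f n * V) m = motzkinStep c f m * V := by
  rcases m with _ | m
  · simp only [motzkinStep]; ring
  · simp only [motzkinStep]; ring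

/-- The weight of the first `k` visits and the first `k` steps of `x`. -/
def prefixWeight {R : Type*} [CommSemiring R] (d : ℕ → R) (c : R) (k : ℕ) (x : ℕ → ℕ) : R :=
  ∏ j ∈ Finset.range k, d (x j) * stepWeight c (x j) (x (j + 1))

/-- A pinned altitude keeps the transfer function a multiple of a point mass, so the prefix
contributes only a scalar. -/
theorem transfer_pinned {R : Type*} [CommSemiring R] (d : ℕ → R) (c V : R) (M k : ℕ) :
    ∀ (φ : ℕ → ℕ → R) (z : ℕ → ℕ), (∀ j < k, ∀ n, φ j n = if n = z j then d n else 0) →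
      (∀ m, transfer c (fun j => φ (j + k)) M m = if m = z k then V else 0) →
      ∀ m, transfer c φ (M + k) m = if m = z 0 then prefixWeight d c k z * V else 0 := by
  induction k with
  | zero => intro φ z _ h m; simpa [prefixWeight] using h m
  | succ k ih =>
    intro φ z hφ h m
    have h1 := ih (fun j => φ (j + 1)) (fun j => z (j + 1)) (fun j hj => hφ (j + 1) (by omega))
      fun m => by simpa only [add_assoc] using h m
    rw [← add_assoc, transfer, funext h1, motzkinStep_single, hφ 0 k.succ_pos]
    simp only [zero_add, prefixWeight, Finset.prod_range_succ' _ k]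
    split_ifs with hm
    · rw [hm]; ring
    · rw [zero_mul]

/-- The factor d z in the hypothesis is the visit to z that the kernel already counts. -/
theorem transfer_free {R : Type*} [CommSemiring R] (d : ℕ → R) (c V : R) (z l M : ℕ) :
    ∀ (φ : ℕ → ℕ → R), (∀ j < M, ∀ n, φ j n = d n) →
      (∀ m, transfer c (fun j => φ (j + M)) l m = if m = z then d z * V else 0) →
      ∀ m, transfer c φ (l + M) m = pathKernel d c M m z * V := by
  induction M with
  | zero =>
    intro φ _ h m
    rw [pathKernel, ite_mul, zero_mul]
    refine (h m).trans ?_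
    split_ifs with hm
    · rw [hm]
    · rfl
  | succ M ih =>
    intro φ hφ h m
    have h1 := ih (fun j => φ (j + 1)) (fun j hj => hφ (j + 1) (by omega))
      fun m => by simpa only [add_assoc] using h m
    rw [← add_assoc, transfer, funext h1, motzkinStep_mul_right, hφ 0 M.succ_pos, pathKernel,
      mul_assoc]

/-- `prefixWeight` omits the visit at time k, so reversal exchanges the omitted endpoint; the
factors d (y 0) and d (y k) restore all k+1 visits on both sides. -/
theorem prefixWeight_reflect {R : Type*} [CommSemiring R] (d : ℕ → R) (c : R) (k : ℕ)
    (y : ℕ → ℕ) : prefixWeight d c k (fun j => y (k - j)) * d (y 0) =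
      d (y k) * prefixWeight d c k y := by
  have h1 := Finset.prod_range_succ (fun j => d (y (k - j))) k
  have h2 := Finset.prod_range_succ (fun j => d (y j)) k
  have h3 := Finset.prod_range_reflect (fun j => d (y j)) (k + 1)
  have h4 := Finset.prod_range_reflect (fun j => stepWeight c (y j) (y (j + 1))) k
  simp only [Nat.add_sub_cancel, Nat.sub_self] at h1 h3
  have h5 : ∏ j ∈ Finset.range k, stepWeight c (y (k - j)) (y (k - (j + 1))) =
      ∏ j ∈ Finset.range k, stepWeight c (y j) (y (j + 1)) := by
    rw [← h4]
    refine Finset.prod_congr rfl fun j hj => ?_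
    have hj' := Finset.mem_range.mp hj
    rw [stepWeight_comm, show k - 1 - j + 1 = k - j by omega, show k - 1 - j = k - (j + 1) by omega]
  simp only [prefixWeight, Finset.prod_mul_distrib, h5]
  rw [mul_right_comm, ← h1, h3, h2]
  ring

/-- The site weights `d`, restricted to the paths of length `L` whose first `k + 1` altitudes are
given by `x` and whose last `k + 1` altitudes are given by `y` in reverse order. -/
def cylinderSite {R : Type*} [Zero R] (d : ℕ → R) (L k : ℕ) (x y : ℕ → ℕ) (j n : ℕ) : R :=
  if (j ≤ k → n = x j) ∧ (L ≤ j + k → n = y (L - j)) then d n else 0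

theorem transfer_restrict {R : Type*} [Semiring R] (c : R) {φ ψ : ℕ → ℕ → R} {z : ℕ}
    (h0 : ∀ n, φ 0 n = if n = z then ψ 0 n else 0) (h : ∀ j, φ (j + 1) = ψ (j + 1)) (L m : ℕ) :
    transfer c φ L m = if m = z then transfer c ψ L m else 0 := by
  rcases L with _ | L
  · exact h0 m
  · rw [transfer, transfer, h0, funext h]
    split_ifs
    · rfl
    · rw [zero_mul]

/-- Every visit is counted once: times before k by the first prefix, k to k+M by the kernel, the
last k by the second prefix. For M = 0 the kernel enforces x k = y k. -/
theorem transfer_cylinderSite {R : Type*} [CommSemiring R] (d : ℕ → R) (c : R) (k M : ℕ)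
    (x y : ℕ → ℕ) (m : ℕ) :
    transfer c (cylinderSite d (k + M + k) k x y) (k + M + k) m =
      if m = x 0 then
        prefixWeight d c k x * (pathKernel d c M (x k) (y k) * prefixWeight d c k y)
      else 0 := by
  -- Only the constraint at the final end is kept; the one at the start is treated last.
  set ψ : ℕ → ℕ → R := fun j n => if k + M + k ≤ j + k → n = y (k + M + k - j) then d n else 0
    with hψ
  have hend : ∀ m, transfer c (fun j => ψ (j + M + k)) k m =
      if m = y k then d (y k) * prefixWeight d c k y else 0 := by
    have hsite : ∀ j n, ψ (j + M + k) n = if n = y (k - j) then d n else 0 := fun j n => by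
      simp only [hψ]
      rw [show k + M + k - (j + M + k) = k - j by omega]
      simp only [show k + M + k ≤ j + M + k + k by omega, true_imp_iff]
    have h1 := transfer_pinned d c (d (y 0)) 0 k (fun j => ψ (j + M + k)) (fun j => y (k - j))
      (fun j _ n => hsite j n) fun m => by
        simp only [transfer, hsite, Nat.sub_self, zero_add]
        split_ifs with hm
        · rw [hm]
        · rfl
    simpa only [zero_add, prefixWeight_reflect, Nat.sub_zero] using h1
  have hmid := transfer_free d c (prefixWeight d c k y) (y k) k M (fun j => ψ (j + k))
    (fun j hj n => by
      simp only [hψ]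
      rw [if_pos fun hc => by omega]) hend
  rw [show k + M + k = (k + M) + k from rfl]
  refine transfer_pinned d c _ (k + M) k _ x (fun j hj n => ?_) (fun m => ?_) m
  · simp only [cylinderSite, hj.le, true_imp_iff]
    congr 1
    exact propext ⟨fun h => h.1, fun h => ⟨h, fun hc => by omega⟩⟩
  · rw [transfer_restrict c (ψ := fun j => ψ (j + k)) (z := x k) (fun n => ?_) (fun j => ?_), hmid]
    · split_ifs with hm
      · rw [hm]
      · rfl
    · simp only [cylinderSite, hψ, zero_add, le_refl, true_imp_iff, ite_and]
    · funext n
      simp only [cylinderSite, hψ, show ¬ j + 1 + k ≤ k by omega, false_imp_iff, true_and]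

/-! ### Paths with prescribed ends -/

theorem MotzkinPath.fromStart_of_le {L k : ℕ} (γ : MotzkinPath L) (hk : k ≤ L) :
    γ.fromStart k = γ.1 ⟨k, Nat.lt_succ_of_le hk⟩ := dif_pos hk

theorem MotzkinPath.fromEnd_of_le {L k : ℕ} (γ : MotzkinPath L) (hk : k ≤ L) :
    γ.fromEnd k = γ.1 ⟨L - k, Nat.lt_succ_of_le (Nat.sub_le L k)⟩ := if_pos hk

/-- The pairs of sequences which agree with `(x, y)` up to time `k`. -/
def cylinder (k : ℕ) (x y : ℕ → ℕ) : Set ((ℕ → ℕ) × (ℕ → ℕ)) :=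
  {p | (∀ j ≤ k, p.1 j = x j) ∧ ∀ j ≤ k, p.2 j = y j}

theorem MotzkinPath.mem_cylinder_iff {L k : ℕ} (γ : MotzkinPath L) (hk : k ≤ L) (x y : ℕ → ℕ) :
    (γ.fromStart, γ.fromEnd) ∈ cylinder k x y ↔
      ∀ j : Fin (L + 1), ((j : ℕ) ≤ k → γ.1 j = x j) ∧ (L ≤ j + k → γ.1 j = y (L - j)) := by
  constructor
  · rintro ⟨h1, h2⟩ j
    have hjL := Nat.lt_succ_iff.mp j.2
    refine ⟨fun hj => ?_, fun hj => ?_⟩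
    · exact (γ.fromStart_of_le hjL).symm.trans (h1 j hj)
    · have h3 : γ.fromEnd (L - j) = y (L - j) := h2 (L - j) (by omega)
      rw [γ.fromEnd_of_le (Nat.sub_le _ _)] at h3
      have h4 : j = ⟨L - (L - j), Nat.lt_succ_of_le (Nat.sub_le _ _)⟩ :=
        Fin.ext (Nat.sub_sub_self hjL).symm
      exact (congrArg γ.1 h4).trans h3
  · intro h
    refine ⟨fun j hj => ?_, fun j hj => ?_⟩
    · exact (γ.fromStart_of_le (hj.trans hk)).trans ((h _).1 hj)
    · change γ.fromEnd j = y j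
      rw [γ.fromEnd_of_le (hj.trans hk)]
      have h3 := (h ⟨L - j, Nat.lt_succ_of_le (Nat.sub_le L j)⟩).2 (by simp only; omega)
      simp only at h3
      rwa [Nat.sub_sub_self (hj.trans hk)] at h3

theorem pathWeight_cylinderSite {R : Type*} [CommSemiring R] (d : ℕ → R) (c : R) (L k : ℕ)
    (x y : ℕ → ℕ) (γ : Fin (L + 1) → ℕ) [Decidable (∀ j : Fin (L + 1),
      ((j : ℕ) ≤ k → γ j = x j) ∧ (L ≤ j + k → γ j = y (L - j)))] :
    pathWeight c (cylinderSite d L k x y) L γ =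
      if ∀ j : Fin (L + 1), ((j : ℕ) ≤ k → γ j = x j) ∧ (L ≤ j + k → γ j = y (L - j))
      then pathWeight c (fun _ => d) L γ else 0 := by
  rw [pathWeight, pathWeight]
  split_ifs with h
  · congr 1
    exact Finset.prod_congr rfl fun j _ => if_pos (h j)
  · push Not at h
    obtain ⟨j, hj⟩ := h
    rw [Finset.prod_eq_zero (Finset.mem_univ j), zero_mul]
    refine if_neg fun hc => ?_
    obtain ⟨h1, h2⟩ | ⟨h1, h2⟩ := (by tauto :
      ((j : ℕ) ≤ k ∧ γ j ≠ x j) ∨ (L ≤ j + k ∧ γ j ≠ y (L - j)))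
    · exact h2 (hc.1 h1)
    · exact h2 (hc.2 h1)

theorem pathWeight_eq_zero {R : Type*} [CommSemiring R] (c : R) (φ : ℕ → ℕ → R) {L : ℕ}
    {γ : Fin (L + 1) → ℕ}
    (h : ¬ ∀ j : Fin L, |(γ j.succ : ℤ) - (γ j.castSucc : ℤ)| ≤ 1) : pathWeight c φ L γ = 0 := by
  push Not at h
  obtain ⟨j, hj⟩ := h
  have h1 : stepWeight c (γ j.castSucc) (γ j.succ) = 0 := by
    unfold stepWeight
    rw [lt_abs] at hj
    rw [if_neg (by omega), if_neg (by omega)]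
  rw [pathWeight, Finset.prod_eq_zero (Finset.mem_univ j) h1, mul_zero]

/-- Summation over all sequences is what the transfer operators compute; a forbidden step has weight
0. -/
theorem tsum_motzkinPath (L : ℕ) {F : (Fin (L + 1) → ℕ) → ENNReal}
    (hF : ∀ γ, (¬ ∀ j : Fin L, |(γ j.succ : ℤ) - (γ j.castSucc : ℤ)| ≤ 1) → F γ = 0) :
    ∑' γ : MotzkinPath L, F γ.1 = ∑' γ, F γ :=
  tsum_subtype_eq_of_support_subset fun γ hγ => by
    by_contra hc
    exact hγ (hF γ hc)

open Classical in
/-- The total weight of the Motzkin paths with prescribed ends. -/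
theorem tsum_cylinder_pathWeight (d : ℕ → ENNReal) (c : ENNReal) (k M : ℕ) (x y : ℕ → ℕ) :
    ∑' γ : MotzkinPath (k + M + k), (if (γ.fromStart, γ.fromEnd) ∈ cylinder k x y then
      pathWeight c (fun _ => d) (k + M + k) γ.1 else 0) =
      prefixWeight d c k x * (pathKernel d c M (x k) (y k) * prefixWeight d c k y) := by
  have hk : k ≤ k + M + k := by omega
  simp only [MotzkinPath.mem_cylinder_iff _ hk, ← pathWeight_cylinderSite]
  rw [tsum_motzkinPath _ fun γ hγ => pathWeight_eq_zero _ _ hγ]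
  have h1 := tsum_mul_pathWeight c (k + M + k) (cylinderSite d (k + M + k) k x y) fun _ => 1
  simp only [one_mul] at h1
  rw [h1]
  simp only [transfer_cylinderSite, tsum_ite_eq]

end

section

variable {q σ ρ₀ ρ₁ : ℝ} {d : ℕ → ℝ} {c : ℝ}

/-! # The law of the two ends of a random Motzkin path -/

/-- The site weight `1 - q ^ (n + 1)`, proportional to `[n + 1]_q`. -/
def siteWeight (q : ℝ) (n : ℕ) : ℝ := 1 - q ^ (n + 1)

theorem admissible_siteWeight (hq₀ : 0 ≤ q) (hq₁ : q < 1) (hσ₀ : 0 < σ) (hσ₁ : σ ≤ 1) :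
    Admissible (siteWeight q) σ where
  pos n := sub_pos.mpr (pow_lt_one₀ hq₀ hq₁ n.succ_ne_zero)
  le_one n := sub_le_self _ (pow_nonneg hq₀ _)
  summable := by
    have hq : 0 < 1 - q := sub_pos.mpr hq₁
    have hpos : ∀ n, 0 < siteWeight q n := fun n =>
      sub_pos.mpr (pow_lt_one₀ hq₀ hq₁ n.succ_ne_zero)
    -- Comparison with 1/d_n - 1 = q^(n+1)/(1-q^(n+1)) ≤ q^n/(1-q).
    refine ((summable_succ_mul_pow hq₀ hq₁).mul_left (1 - q)⁻¹).of_nonneg_of_le (fun n => ?_)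
      fun n => ?_
    · exact mul_nonneg (by positivity) (sub_nonneg.mpr ((one_le_inv₀ (hpos n)).mpr
        (sub_le_self _ (pow_nonneg hq₀ _))))
    · rw [mul_left_comm]
      refine mul_le_mul_of_nonneg_left ?_ (by positivity)
      have h1 : (siteWeight q n)⁻¹ - 1 = q ^ (n + 1) / siteWeight q n := by
        have := (hpos n).ne'
        field_simp
        rw [siteWeight]; ring
      have h2 : q ^ (n + 1) ≤ q := pow_le_of_le_one hq₀ hq₁.le n.succ_ne_zero
      rw [h1, div_le_iff₀ (hpos n), inv_mul_eq_div, div_mul_eq_mul_div, le_div_iff₀ hq, siteWeight]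
      have h3 : q ^ (n + 1) ≤ q ^ n := pow_le_pow_of_le_one hq₀ hq₁.le n.le_succ
      exact mul_le_mul h3 (by linarith) hq.le (by positivity)
  sigma_pos := hσ₀
  sigma_le_one := hσ₁

/-- The recurrence of s is the eigenvalue equation at the upper edge, with s_0 = 1. -/
theorem s_eq_orthPoly (hq₀ : 0 ≤ q) (hq₁ : q < 1) (hσ₀ : 0 < σ) (hσ₁ : σ ≤ 1) (n : ℕ) :
    s q σ n = orthPoly (siteWeight q) σ (2 + 2 * σ) n := by
  have hq : |q| < 1 := by rwa [abs_of_nonneg hq₀]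
  have h := eq_orthPoly_mul (admissible_siteWeight hq₀ hq₁ hσ₀ hσ₁).pos (f := s q σ) (σ := σ)
    (x := 2 + 2 * σ) (N := n) (fun m _ => ?_) n le_rfl
  · rw [h, s_zero, mul_one]
  · rcases m with _ | m
    · have h1 := s_one hq hσ₀.le hσ₁
      simp only [motzkinStep, siteWeight, s_zero]
      linear_combination h1
    · exact s_add_two hq hσ₀.le hσ₁ m

/-! ### Transfer between real and extended nonnegative weights -/

theorem ofReal_motzkinStep (hc : 0 ≤ c) {f : ℕ → ℝ} (hf : ∀ n, 0 ≤ f n) (m : ℕ) :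
    ENNReal.ofReal (motzkinStep c f m) =
      motzkinStep (ENNReal.ofReal c) (fun n => ENNReal.ofReal (f n)) m := by
  rcases m with _ | m
  · simp only [motzkinStep]
    rw [ENNReal.ofReal_add (hf 1) (mul_nonneg hc (hf 0)), ENNReal.ofReal_mul hc]
  · simp only [motzkinStep]
    rw [ENNReal.ofReal_add (add_nonneg (hf _) (mul_nonneg hc (hf _))) (hf _),
      ENNReal.ofReal_add (hf _) (mul_nonneg hc (hf _)), ENNReal.ofReal_mul hc]

theorem Admissible.ofReal_pathKernel (h : Admissible d σ) (L : ℕ) : ∀ m n,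
    ENNReal.ofReal (pathKernel d (2 * σ) L m n) =
      pathKernel (fun k => ENNReal.ofReal (d k)) (ENNReal.ofReal (2 * σ)) L m n := by
  have hσ : 0 ≤ 2 * σ := by linarith [h.sigma_pos]
  induction L with
  | zero => intro m n; simp only [pathKernel]; split_ifs <;> simp
  | succ L ih =>
    intro m n
    rw [pathKernel, pathKernel, ENNReal.ofReal_mul (h.pos m).le,
      ofReal_motzkinStep hσ fun k => h.pathKernel_nonneg L k n]
    simp only [ih]

theorem stepWeight_nonneg (hc : 0 ≤ c) (m n : ℕ) : 0 ≤ stepWeight c m n := by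
  unfold stepWeight
  split_ifs
  exacts [hc, zero_le_one, le_rfl]

theorem ofReal_stepWeight (m n : ℕ) :
    ENNReal.ofReal (stepWeight c m n) = stepWeight (ENNReal.ofReal c) m n := by
  unfold stepWeight
  split_ifs <;> simp

theorem prefixWeight_nonneg (hd : ∀ n, 0 ≤ d n) (hc : 0 ≤ c) (k : ℕ) (x : ℕ → ℕ) :
    0 ≤ prefixWeight d c k x :=
  Finset.prod_nonneg fun _ _ => mul_nonneg (hd _) (stepWeight_nonneg hc _ _)

theorem ofReal_prefixWeight (hd : ∀ n, 0 ≤ d n) (hc : 0 ≤ c) (k : ℕ) (x : ℕ → ℕ) :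
    ENNReal.ofReal (prefixWeight d c k x) =
      prefixWeight (fun k => ENNReal.ofReal (d k)) (ENNReal.ofReal c) k x := by
  rw [prefixWeight, ENNReal.ofReal_prod_of_nonneg fun _ _ =>
    mul_nonneg (hd _) (stepWeight_nonneg hc _ _)]
  refine Finset.prod_congr rfl fun j _ => ?_
  rw [ENNReal.ofReal_mul (hd _), ofReal_stepWeight]

theorem qNumber_succ (hq₁ : q < 1) (n : ℕ) : qNumber q (n + 1) = (1 - q)⁻¹ * siteWeight q n := by
  have h : 1 - q ≠ 0 := (sub_pos.mpr hq₁).ne'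
  rw [qNumber, siteWeight, ← mul_neg_geom_sum, inv_mul_cancel_left₀ h]

theorem MotzkinPath.prod_stepWeight {L : ℕ} (γ : MotzkinPath L) (c : ℝ) :
    ∏ j : Fin L, stepWeight c (γ.1 j.castSucc) (γ.1 j.succ) = c ^ γ.horizontalSteps := by
  have h1 : ∀ j : Fin L, stepWeight c (γ.1 j.castSucc) (γ.1 j.succ) =
      if γ.1 j.succ = γ.1 j.castSucc then c else 1 := by
    intro j
    have h2 := abs_le.mp (γ.2 j)
    unfold stepWeight
    split_ifs <;> first | rfl | omega
  simp only [h1]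
  rw [Finset.prod_ite, Finset.prod_const, Finset.prod_const_one, mul_one, horizontalSteps]

theorem motzkinWeight_eq (hq₁ : q < 1) {L : ℕ} (γ : MotzkinPath L) :
    motzkinWeight q σ ρ₀ ρ₁ γ = (1 - q)⁻¹ ^ (L + 1) * (ρ₀ ^ γ.1 0 * ρ₁ ^ γ.1 (Fin.last L)) *
      pathWeight (2 * σ) (fun _ => siteWeight q) L γ.1 := by
  rw [motzkinWeight, pathWeight, γ.prod_stepWeight]
  simp only [qNumber_succ hq₁, Finset.prod_mul_distrib, Finset.prod_const, Finset.card_univ,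
    Fintype.card_fin]
  ring

theorem ofReal_pathWeight (hd : ∀ n, 0 ≤ d n) (hc : 0 ≤ c) {L : ℕ} (γ : Fin (L + 1) → ℕ) :
    ENNReal.ofReal (pathWeight c (fun _ => d) L γ) =
      pathWeight (ENNReal.ofReal c) (fun _ n => ENNReal.ofReal (d n)) L γ := by
  rw [pathWeight, pathWeight, ENNReal.ofReal_mul (Finset.prod_nonneg fun _ _ => hd _),
    ENNReal.ofReal_prod_of_nonneg fun _ _ => hd _,
    ENNReal.ofReal_prod_of_nonneg fun _ _ => stepWeight_nonneg hc _ _]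
  simp only [ofReal_stepWeight]

theorem MotzkinPath.endpoints_of_mem_cylinder {L k : ℕ} {γ : MotzkinPath L} {x y : ℕ → ℕ}
    (h : (γ.fromStart, γ.fromEnd) ∈ cylinder k x y) :
    γ.1 0 = x 0 ∧ γ.1 (Fin.last L) = y 0 :=
  ⟨(γ.fromStart_of_le (Nat.zero_le L)).symm.trans (h.1 0 (Nat.zero_le k)),
    (γ.fromEnd_of_le (Nat.zero_le L)).symm.trans (h.2 0 (Nat.zero_le k))⟩

/-- The unnormalized weight of the sequences with prescribed ends. -/
def endsWeight (q σ ρ₀ ρ₁ : ℝ) (k M : ℕ) (x y : ℕ → ℕ) : ℝ :=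
  ρ₀ ^ x 0 * ρ₁ ^ y 0 * (prefixWeight (siteWeight q) (2 * σ) k x *
    (pathKernel (siteWeight q) (2 * σ) M (x k) (y k) * prefixWeight (siteWeight q) (2 * σ) k y))

-- The endpoint factors ρ₀^γ_0 ρ₁^γ_L are constant on a cylinder and leave the sum.
open Classical in
theorem tsum_cylinder_motzkinWeight (hq₀ : 0 ≤ q) (hq₁ : q < 1) (hσ₀ : 0 < σ) (hσ₁ : σ ≤ 1)
    (hρ₀ : 0 ≤ ρ₀) (hρ₁ : 0 ≤ ρ₁) {L k M : ℕ} (hL : L = k + M + k) (x y : ℕ → ℕ) :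
    ∑' γ : MotzkinPath L, (if (γ.fromStart, γ.fromEnd) ∈ cylinder k x y then
      ENNReal.ofReal (motzkinWeight q σ ρ₀ ρ₁ γ) else 0) =
      ENNReal.ofReal ((1 - q)⁻¹ ^ (L + 1) * endsWeight q σ ρ₀ ρ₁ k M x y) := by
  subst hL
  have h := admissible_siteWeight hq₀ hq₁ hσ₀ hσ₁
  have hd := fun n => (h.pos n).le
  have hσ : 0 ≤ 2 * σ := by linarith
  have hq : 0 ≤ (1 - q)⁻¹ := inv_nonneg.mpr (sub_nonneg.mpr hq₁.le)
  have hc : 0 ≤ (1 - q)⁻¹ ^ (k + M + k + 1) * (ρ₀ ^ x 0 * ρ₁ ^ y 0) := by positivity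
  have h1 := tsum_cylinder_pathWeight (fun n => ENNReal.ofReal (siteWeight q n))
    (ENNReal.ofReal (2 * σ)) k M x y
  rw [← ofReal_prefixWeight hd hσ, ← ofReal_prefixWeight hd hσ, ← h.ofReal_pathKernel,
    ← ENNReal.ofReal_mul (h.pathKernel_nonneg _ _ _),
    ← ENNReal.ofReal_mul (prefixWeight_nonneg hd hσ _ _)] at h1
  rw [endsWeight, ← mul_assoc, ENNReal.ofReal_mul hc, ← h1, ← ENNReal.tsum_mul_left]
  refine tsum_congr fun γ => ?_
  rw [mul_ite, mul_zero]
  split_ifs with hγ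
  · obtain ⟨e0, e1⟩ := MotzkinPath.endpoints_of_mem_cylinder hγ
    rw [motzkinWeight_eq hq₁, e0, e1, ENNReal.ofReal_mul hc, ofReal_pathWeight hd hσ]
  · rfl

/-- The total weight of the paths of length `L`, up to a power of `1 - q`. -/
def totalWeight (q σ ρ₀ ρ₁ : ℝ) (L : ℕ) : ℝ :=
  ∑' p : ℕ × ℕ, ρ₀ ^ p.1 * ρ₁ ^ p.2 * pathKernel (siteWeight q) (2 * σ) L p.1 p.2

/-- The cylinders with k = 0 partition the paths according to their endpoints. -/
theorem tsum_ofReal_motzkinWeight (hq₀ : 0 ≤ q) (hq₁ : q < 1) (hσ₀ : 0 < σ) (hσ₁ : σ ≤ 1)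
    (hρ₀ : 0 ≤ ρ₀) (hρ₀' : ρ₀ < 1) (hρ₁ : 0 ≤ ρ₁) (hρ₁' : ρ₁ < 1) (L : ℕ) :
    ∑' γ : MotzkinPath L, ENNReal.ofReal (motzkinWeight q σ ρ₀ ρ₁ γ) =
      ENNReal.ofReal ((1 - q)⁻¹ ^ (L + 1) * totalWeight q σ ρ₀ ρ₁ L) := by
  classical
  have h := admissible_siteWeight hq₀ hq₁ hσ₀ hσ₁
  have hq : 0 ≤ (1 - q)⁻¹ := inv_nonneg.mpr (sub_nonneg.mpr hq₁.le)
  rw [totalWeight, ← tsum_mul_left, ENNReal.ofReal_tsum_of_nonneg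
    (fun p => mul_nonneg (pow_nonneg hq _) (mul_nonneg (by positivity) (h.pathKernel_nonneg _ _ _)))
    ((h.summable_pow_mul_pathKernel hρ₀ hρ₀' hρ₁ hρ₁' L).mul_left _)]
  calc ∑' γ : MotzkinPath L, ENNReal.ofReal (motzkinWeight q σ ρ₀ ρ₁ γ)
      = ∑' (γ : MotzkinPath L) (p : ℕ × ℕ),
          (if (γ.fromStart, γ.fromEnd) ∈ cylinder 0 (fun _ => p.1) (fun _ => p.2) then
            ENNReal.ofReal (motzkinWeight q σ ρ₀ ρ₁ γ) else 0) := by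
        refine tsum_congr fun γ => ?_
        rw [tsum_eq_single (γ.1 0, γ.1 (Fin.last L)), if_pos]
        · refine ⟨fun j hj => ?_, fun j hj => ?_⟩
          · rw [Nat.le_zero.mp hj]; exact γ.fromStart_of_le (Nat.zero_le L)
          · rw [Nat.le_zero.mp hj]; exact γ.fromEnd_of_le (Nat.zero_le L)
        · intro p hp
          refine if_neg fun hc => hp ?_
          obtain ⟨e0, e1⟩ := MotzkinPath.endpoints_of_mem_cylinder hc
          rw [e0, e1]
    _ = _ := by
        rw [ENNReal.tsum_comm]
        refine tsum_congr fun p => ?_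
        rw [tsum_cylinder_motzkinWeight hq₀ hq₁ hσ₀ hσ₁ hρ₀ hρ₁ (M := L) (by omega)]
        simp [endsWeight, prefixWeight]

theorem totalWeight_pos (hq₀ : 0 ≤ q) (hq₁ : q < 1) (hσ₀ : 0 < σ) (hσ₁ : σ ≤ 1)
    (hρ₀ : 0 ≤ ρ₀) (hρ₀' : ρ₀ < 1) (hρ₁ : 0 ≤ ρ₁) (hρ₁' : ρ₁ < 1) (L : ℕ) :
    0 < totalWeight q σ ρ₀ ρ₁ L := by
  have h := admissible_siteWeight hq₀ hq₁ hσ₀ hσ₁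
  refine (h.summable_pow_mul_pathKernel hρ₀ hρ₀' hρ₁ hρ₁' L).tsum_pos
    (fun p => mul_nonneg (by positivity) (h.pathKernel_nonneg _ _ _)) (0, 0) ?_
  simpa using h.pathKernel_zero_pos L

theorem motzkinWeight_nonneg (hq₀ : 0 ≤ q) (hσ₀ : 0 < σ) (hρ₀ : 0 ≤ ρ₀) (hρ₁ : 0 ≤ ρ₁) {L : ℕ}
    (γ : MotzkinPath L) : 0 ≤ motzkinWeight q σ ρ₀ ρ₁ γ := by
  refine mul_nonneg (by positivity) (Finset.prod_nonneg fun k _ => Finset.sum_nonneg fun i _ => ?_)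
  positivity

theorem motzkinNorm_eq (hq₀ : 0 ≤ q) (hq₁ : q < 1) (hσ₀ : 0 < σ) (hσ₁ : σ ≤ 1)
    (hρ₀ : 0 ≤ ρ₀) (hρ₀' : ρ₀ < 1) (hρ₁ : 0 ≤ ρ₁) (hρ₁' : ρ₁ < 1) (L : ℕ) :
    motzkinNorm q σ ρ₀ ρ₁ L = (1 - q)⁻¹ ^ (L + 1) * totalWeight q σ ρ₀ ρ₁ L := by
  have hq : 0 ≤ (1 - q)⁻¹ := inv_nonneg.mpr (sub_nonneg.mpr hq₁.le)
  have h1 := congrArg ENNReal.toReal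
    (tsum_ofReal_motzkinWeight hq₀ hq₁ hσ₀ hσ₁ hρ₀ hρ₀' hρ₁ hρ₁' L)
  rw [ENNReal.tsum_toReal_eq fun γ => ENNReal.ofReal_ne_top, ENNReal.toReal_ofReal
    (mul_nonneg (pow_nonneg hq _)
      (totalWeight_pos hq₀ hq₁ hσ₀ hσ₁ hρ₀ hρ₀' hρ₁ hρ₁' L).le)] at h1
  rw [motzkinNorm, ← h1]
  exact tsum_congr fun γ => (ENNReal.toReal_ofReal (motzkinWeight_nonneg hq₀ hσ₀ hρ₀ hρ₁ γ)).symm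

theorem motzkinNorm_pos (hq₀ : 0 ≤ q) (hq₁ : q < 1) (hσ₀ : 0 < σ) (hσ₁ : σ ≤ 1)
    (hρ₀ : 0 ≤ ρ₀) (hρ₀' : ρ₀ < 1) (hρ₁ : 0 ≤ ρ₁) (hρ₁' : ρ₁ < 1) (L : ℕ) :
    0 < motzkinNorm q σ ρ₀ ρ₁ L := by
  rw [motzkinNorm_eq hq₀ hq₁ hσ₀ hσ₁ hρ₀ hρ₀' hρ₁ hρ₁']
  exact mul_pos (pow_pos (inv_pos.mpr (sub_pos.mpr hq₁)) _)
    (totalWeight_pos hq₀ hq₁ hσ₀ hσ₁ hρ₀ hρ₀' hρ₁ hρ₁' L)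

open Classical in
theorem motzkinLaw_apply (hZ : 0 < motzkinNorm q σ ρ₀ ρ₁ L) (E : Set (MotzkinPath L)) :
    motzkinLaw q σ ρ₀ ρ₁ L E = (∑' γ : MotzkinPath L, if γ ∈ E then
      ENNReal.ofReal (motzkinWeight q σ ρ₀ ρ₁ γ) else 0) /
        ENNReal.ofReal (motzkinNorm q σ ρ₀ ρ₁ L) := by
  have hE : MeasurableSet E := MeasurableSpace.measurableSet_top
  rw [motzkinLaw, Measure.sum_apply _ hE, div_eq_mul_inv, ← ENNReal.tsum_mul_right]
  refine tsum_congr fun γ => ?_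
  rw [Measure.smul_apply, Measure.dirac_apply' _ hE, ENNReal.ofReal_div_of_pos hZ,
    Set.indicator_apply]
  split_ifs <;> simp [div_eq_mul_inv]

theorem isProbabilityMeasure_motzkinLaw (hq₀ : 0 ≤ q) (hq₁ : q < 1) (hσ₀ : 0 < σ) (hσ₁ : σ ≤ 1)
    (hρ₀ : 0 ≤ ρ₀) (hρ₀' : ρ₀ < 1) (hρ₁ : 0 ≤ ρ₁) (hρ₁' : ρ₁ < 1) (L : ℕ) :
    IsProbabilityMeasure (motzkinLaw q σ ρ₀ ρ₁ L) := by
  have hZ := motzkinNorm_pos hq₀ hq₁ hσ₀ hσ₁ hρ₀ hρ₀' hρ₁ hρ₁' L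
  constructor
  classical
  rw [motzkinLaw_apply hZ]
  simp only [Set.mem_univ, if_true]
  rw [tsum_ofReal_motzkinWeight hq₀ hq₁ hσ₀ hσ₁ hρ₀ hρ₀' hρ₁ hρ₁',
    ← motzkinNorm_eq hq₀ hq₁ hσ₀ hσ₁ hρ₀ hρ₀' hρ₁ hρ₁']
  exact ENNReal.div_self (ENNReal.ofReal_pos.mpr hZ).ne' ENNReal.ofReal_ne_top

theorem motzkinLaw_cylinder (hq₀ : 0 ≤ q) (hq₁ : q < 1) (hσ₀ : 0 < σ) (hσ₁ : σ ≤ 1)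
    (hρ₀ : 0 ≤ ρ₀) (hρ₀' : ρ₀ < 1) (hρ₁ : 0 ≤ ρ₁) (hρ₁' : ρ₁ < 1) {L k M : ℕ}
    (hL : L = k + M + k) (x y : ℕ → ℕ) :
    motzkinLaw q σ ρ₀ ρ₁ L {γ | (γ.fromStart, γ.fromEnd) ∈ cylinder k x y} =
      ENNReal.ofReal (endsWeight q σ ρ₀ ρ₁ k M x y / totalWeight q σ ρ₀ ρ₁ L) := by
  have hZ := motzkinNorm_pos hq₀ hq₁ hσ₀ hσ₁ hρ₀ hρ₀' hρ₁ hρ₁' L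
  have hκ : (1 - q)⁻¹ ^ (L + 1) ≠ 0 := (pow_pos (inv_pos.mpr (sub_pos.mpr hq₁)) _).ne'
  classical
  rw [motzkinLaw_apply hZ]
  simp only [Set.mem_ofPred_eq]
  rw [tsum_cylinder_motzkinWeight hq₀ hq₁ hσ₀ hσ₁ hρ₀ hρ₁ hL, ← ENNReal.ofReal_div_of_pos hZ,
    motzkinNorm_eq hq₀ hq₁ hσ₀ hσ₁ hρ₀ hρ₀' hρ₁ hρ₁', mul_div_mul_left _ _ hκ]

theorem s_pos (hq₀ : 0 ≤ q) (hq₁ : q < 1) (hσ₀ : 0 < σ) (hσ₁ : σ ≤ 1) (n : ℕ) : 0 < s q σ n := by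
  rw [s_eq_orthPoly hq₀ hq₁ hσ₀ hσ₁]
  exact (admissible_siteWeight hq₀ hq₁ hσ₀ hσ₁).orthPoly_pos n

theorem normConst_pos {ρ : ℝ} (hq₀ : 0 ≤ q) (hq₁ : q < 1) (hσ₀ : 0 < σ) (hσ₁ : σ ≤ 1)
    (hρ : 0 ≤ ρ) (hρ' : ρ < 1) : 0 < normConst q σ ρ := by
  have h := hasSum_s_mul_pow (q := q) (σ := σ) (by rwa [abs_of_nonneg hq₀])
    (show |ρ| < 1 by rwa [abs_of_nonneg hρ])
  have h0 := le_hasSum h 0 fun n _ =>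
    mul_nonneg (pow_nonneg hρ n) (s_pos hq₀ hq₁ hσ₀ hσ₁ n).le
  rw [pow_zero, one_mul, s_zero] at h0
  exact one_pos.trans_le h0

/-- The limit of the law of an end of the random path on cylinders. -/
def endLimit (q σ ρ : ℝ) (k : ℕ) (x : ℕ → ℕ) : ℝ :=
  ρ ^ x 0 * prefixWeight (siteWeight q) (2 * σ) k x * s q σ (x k) /
    ((2 + 2 * σ) ^ k * normConst q σ ρ)

/-- Numerator and normalization are both divided by K_{M+2k}(0,0). The shift by 2k produces Λ^(-2k),
shared equally by the two ends. -/
theorem tendsto_motzkinLaw_cylinder (hq₀ : 0 ≤ q) (hq₁ : q < 1) (hσ₀ : 0 < σ) (hσ₁ : σ ≤ 1)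
    (hρ₀ : 0 ≤ ρ₀) (hρ₀' : ρ₀ < 1) (hρ₁ : 0 ≤ ρ₁) (hρ₁' : ρ₁ < 1) (k : ℕ) (x y : ℕ → ℕ) :
    Tendsto (fun L => motzkinLaw q σ ρ₀ ρ₁ L {γ | (γ.fromStart, γ.fromEnd) ∈ cylinder k x y})
      atTop (𝓝 (ENNReal.ofReal (endLimit q σ ρ₀ k x * endLimit q σ ρ₁ k y))) := by
  have h := admissible_siteWeight hq₀ hq₁ hσ₀ hσ₁
  have hC₀ := normConst_pos hq₀ hq₁ hσ₀ hσ₁ hρ₀ hρ₀'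
  have hC₁ := normConst_pos hq₀ hq₁ hσ₀ hσ₁ hρ₁ hρ₁'
  rw [← tendsto_add_atTop_iff_nat (2 * k)]
  have hlaw : ∀ M, motzkinLaw q σ ρ₀ ρ₁ (M + 2 * k)
      {γ | (γ.fromStart, γ.fromEnd) ∈ cylinder k x y} =
      ENNReal.ofReal (endsWeight q σ ρ₀ ρ₁ k M x y / totalWeight q σ ρ₀ ρ₁ (M + 2 * k)) :=
    fun M => motzkinLaw_cylinder hq₀ hq₁ hσ₀ hσ₁ hρ₀ hρ₀' hρ₁ hρ₁' (by omega) x y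
  simp only [hlaw]
  refine (ENNReal.continuous_ofReal.tendsto _).comp ?_
  have hZ := (tendsto_add_atTop_iff_nat (2 * k)).mpr
    (h.tendsto_tsum_pathKernel_div hρ₀ hρ₀' hρ₁ hρ₁')
  have hK := h.tendsto_pathKernel_add_div (x k) (y k) (2 * k)
  simp only [← s_eq_orthPoly hq₀ hq₁ hσ₀ hσ₁] at hZ hK
  rw [(hasSum_s_mul_pow (by rwa [abs_of_nonneg hq₀]) (by rwa [abs_of_nonneg hρ₀])).tsum_eq,
    (hasSum_s_mul_pow (by rwa [abs_of_nonneg hq₀]) (by rwa [abs_of_nonneg hρ₁])).tsum_eq] at hZ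
  have hlim := (hK.div hZ (mul_pos hC₀ hC₁).ne').const_mul (ρ₀ ^ x 0 * ρ₁ ^ y 0 *
    (prefixWeight (siteWeight q) (2 * σ) k x * prefixWeight (siteWeight q) (2 * σ) k y))
  have hval : endLimit q σ ρ₀ k x * endLimit q σ ρ₁ k y = ρ₀ ^ x 0 * ρ₁ ^ y 0 *
      (prefixWeight (siteWeight q) (2 * σ) k x * prefixWeight (siteWeight q) (2 * σ) k y) *
      (s q σ (x k) * s q σ (y k) / (2 + 2 * σ) ^ (2 * k) /
        (normConst q σ ρ₀ * normConst q σ ρ₁)) := by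
    rw [endLimit, endLimit, two_mul k, pow_add]
    field_simp
  rw [hval]
  refine hlim.congr fun M => ?_
  have ha := (h.pathKernel_zero_pos (M + 2 * k)).ne'
  simp only [Pi.div_apply]
  rw [div_div_div_cancel_right₀ ha, endsWeight, totalWeight]
  ring

end

section

/-! # Markov chains on `ℕ` -/

theorem setOf_forall_le_succ {Ω : Type*} (X : ℕ → Ω → ℕ) (x : ℕ → ℕ) (k : ℕ) :
    {ω | ∀ j ≤ k + 1, X j ω = x j} =
      {ω | ∀ j ≤ k, X j ω = x j} ∩ {ω | X (k + 1) ω = x (k + 1)} := by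
  ext ω
  refine ⟨fun h => ⟨fun j hj => h j (by omega), h _ le_rfl⟩, fun h j hj => ?_⟩
  rcases Nat.lt_or_ge k j with hc | hc
  · obtain rfl : j = k + 1 := by omega
    exact h.2
  · exact h.1 j hc

theorem measurableSet_forall_le {Ω : Type*} [MeasurableSpace Ω] {X : ℕ → Ω → ℕ}
    (hX : ∀ k, Measurable (X k)) (x : ℕ → ℕ) (k : ℕ) :
    MeasurableSet {ω | ∀ j ≤ k, X j ω = x j} := by
  have h : {ω | ∀ j ≤ k, X j ω = x j} = ⋂ j, ⋂ (_ : j ≤ k), X j ⁻¹' {x j} := by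
    ext ω; simp
  rw [h]
  exact .iInter fun j => .iInter fun _ => hX j (measurableSet_singleton _)

/-- The cylinder probabilities of a Markov chain. -/
theorem IsMarkovChain.measureReal_forall_le {Ω : Type*} [MeasurableSpace Ω] {P : Measure Ω}
    [IsProbabilityMeasure P] {X : ℕ → Ω → ℕ} {init : ℕ → ℝ} {p : ℕ → ℕ → ℝ}
    (h : IsMarkovChain P X init p) (x : ℕ → ℕ) (k : ℕ) :
    P.real {ω | ∀ j ≤ k, X j ω = x j} =
      init (x 0) * ∏ j ∈ Finset.range k, p (x j) (x (j + 1)) := by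
  induction k with
  | zero =>
    rw [Finset.prod_range_zero, mul_one, ← h.initial]
    congr 1
    ext ω
    simp
  | succ k ih =>
    rw [setOf_forall_le_succ, Finset.prod_range_succ, ← mul_assoc, ← ih]
    -- The transition law says nothing after a null history; there both sides vanish.
    by_cases h0 : P {ω | ∀ j ≤ k, X j ω = x j} = 0
    · rw [measureReal_def, measureReal_def, h0, measure_mono_null Set.inter_subset_left h0]
      simp
    · have h1 := h.transition k x (x (k + 1)) h0
      rw [measureReal_def, cond_apply (measurableSet_forall_le h.measurable x k), ENNReal.toReal_mul,
      ENNReal.toReal_inv, ← measureReal_def, ← measureReal_def] at h1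
      have h2 : P.real {ω | ∀ j ≤ k, X j ω = x j} ≠ 0 := by
        rwa [Ne, measureReal_def, ENNReal.toReal_eq_zero_iff, or_iff_left (measure_ne_top _ _)]
      rw [← h1, mul_inv_cancel_left₀ h2]

/-- The measure on `ℕ` with masses `f n`. -/
def discreteMeasure (f : ℕ → ℝ) : Measure ℕ :=
  Measure.sum fun n => ENNReal.ofReal (f n) • Measure.dirac n

theorem discreteMeasure_singleton (f : ℕ → ℝ) (n : ℕ) :
    discreteMeasure f {n} = ENNReal.ofReal (f n) := by
  rw [discreteMeasure, Measure.sum_apply _ (measurableSet_singleton _), tsum_eq_single n]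
  · simp
  · intro m hm
    simp [hm]

theorem isProbabilityMeasure_discreteMeasure {f : ℕ → ℝ}
    (hf : ∑' n, ENNReal.ofReal (f n) = 1) : IsProbabilityMeasure (discreteMeasure f) := by
  constructor
  rw [discreteMeasure, Measure.sum_apply _ .univ, ← hf]
  simp

/-- The Markov kernel on `ℕ` with transition probabilities `p`, applied to the last point of a
trajectory. -/
def stepKernel (p : ℕ → ℕ → ℝ) (n : ℕ) :
    Kernel ((i : Finset.Iic n) → (fun _ : ℕ => ℕ) i) ℕ :=
  Kernel.comap (Kernel.ofFunOfCountable fun m => discreteMeasure (p m))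
    (fun x => x ⟨n, Finset.mem_Iic.mpr le_rfl⟩) (measurable_pi_apply _)

theorem isMarkovKernel_stepKernel {p : ℕ → ℕ → ℝ}
    (hp : ∀ m, ∑' n, ENNReal.ofReal (p m n) = 1) (n : ℕ) : IsMarkovKernel (stepKernel p n) :=
  ⟨fun _ => isProbabilityMeasure_discreteMeasure (hp _)⟩

/-- Existence of Markov chains on `ℕ`. -/
theorem exists_isMarkovChain {init : ℕ → ℝ} {p : ℕ → ℕ → ℝ} (hi : ∀ n, 0 ≤ init n)
    (hi' : ∑' n, ENNReal.ofReal (init n) = 1) (hp : ∀ m n, 0 ≤ p m n)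
    (hp' : ∀ m, ∑' n, ENNReal.ofReal (p m n) = 1) :
    ∃ P : Measure (ℕ → ℕ), IsProbabilityMeasure P ∧
      IsMarkovChain P (fun k ω => ω k) init p := by
  have := isProbabilityMeasure_discreteMeasure hi'
  have := isMarkovKernel_stepKernel hp'
  set P : Measure (ℕ → ℕ) :=
    Kernel.trajMeasure (X := fun _ => ℕ) (discreteMeasure init) (stepKernel p) with hP
  have hPprob : IsProbabilityMeasure P := by rw [hP]; infer_instance
  refine ⟨P, hPprob, fun k => measurable_pi_apply k, fun n => ?_, fun k x m h0 => ?_⟩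
  · have h1 : P.map (Preorder.frestrictLe (π := fun _ : ℕ => ℕ) 0) =
        (discreteMeasure init).map
          (MeasurableEquiv.piUnique (fun _ : Finset.Iic 0 => ℕ)).symm := by
      rw [hP, Kernel.trajMeasure, Measure.map_comp _ _ (by fun_prop),
        Kernel.traj_map_frestrictLe_of_le le_rfl, Measure.deterministic_comp_eq_map]
      convert! Measure.map_id
    have hev : Measurable fun z : Finset.Iic 0 → ℕ => z ⟨0, Finset.mem_Iic.mpr le_rfl⟩ :=
      measurable_pi_apply _
    have hm := hev (measurableSet_singleton n)
    have h2 := congrArg (fun μ => μ ((fun z => z ⟨0, Finset.mem_Iic.mpr le_rfl⟩) ⁻¹' {n})) h1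
    beta_reduce at h2
    rw [Measure.map_apply (by fun_prop) hm, Measure.map_apply (by fun_prop) hm] at h2
    have h3 : P {ω | ω 0 = n} = discreteMeasure init {n} := h2
    rw [measureReal_def, h3, discreteMeasure_singleton, ENNReal.toReal_ofReal (hi n)]
  · have hE := measurableSet_forall_le (X := fun k (ω : ℕ → ℕ) => ω k)
      (fun k => measurable_pi_apply k) x k
    set z : (i : Finset.Iic k) → ℕ := fun i => x i with hz
    have hpre : {ω : ℕ → ℕ | ∀ j ≤ k, ω j = x j} = Preorder.frestrictLe (π := fun _ : ℕ => ℕ) k ⁻¹' {z} := by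
      ext ω
      simp only [Set.mem_ofPred_eq, Set.mem_preimage, Set.mem_singleton_iff, funext_iff,
        Subtype.forall, Finset.mem_Iic]
      rfl
    -- The joint law of history and next state, evaluated at a single point, is the probability of
    -- the history times the transition probability.
    have h1 := congrArg (fun μ => μ ({z} ×ˢ {m}))
      (Kernel.map_frestrictLe_trajMeasure_compProd_eq_map_trajMeasure (X := fun _ => ℕ)
        (μ₀ := discreteMeasure init) (κ := stepKernel p) (a := k))
    simp only [← hP] at h1
    rw [Measure.compProd_apply_prod (measurableSet_singleton _) (measurableSet_singleton _),
      Measure.restrict_singleton, lintegral_smul_measure, lintegral_dirac,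
      Measure.map_apply (by fun_prop) (measurableSet_singleton _), ← hpre,
      Measure.map_apply (by fun_prop)
        ((measurableSet_singleton _).prod (measurableSet_singleton _))] at h1
    have h2 : stepKernel p k z {m} = ENNReal.ofReal (p (x k) m) :=
      discreteMeasure_singleton _ _
    have h3 : (fun ω : ℕ → ℕ => (Preorder.frestrictLe (π := fun _ : ℕ => ℕ) k ω, ω (k + 1))) ⁻¹' ({z} ×ˢ {m}) =
        {ω | ∀ j ≤ k, ω j = x j} ∩ {ω | ω (k + 1) = m} := by
      rw [hpre]; ext ω; rfl
    rw [h2, smul_eq_mul] at h1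
    rw [measureReal_def, cond_apply hE]
    erw [← h3, ← h1]
    rw [← mul_assoc, ENNReal.inv_mul_cancel h0 (measure_ne_top _ _), one_mul,
      ENNReal.toReal_ofReal (hp _ _)]

theorem IsMarkovChain.comp {Ω Ω' : Type*} [MeasurableSpace Ω] [MeasurableSpace Ω']
    {P : Measure Ω} {P' : Measure Ω'} {X : ℕ → Ω → ℕ} {init : ℕ → ℝ} {p : ℕ → ℕ → ℝ}
    (h : IsMarkovChain P X init p) {f : Ω' → Ω} (hf : MeasurePreserving f P' P) :
    IsMarkovChain P' (fun k ω => X k (f ω)) init p := by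
  have hm : ∀ k n, MeasurableSet {ω | X k ω = n} := fun k n =>
    h.measurable k (measurableSet_singleton n)
  refine ⟨fun k => (h.measurable k).comp hf.measurable, fun n => ?_, fun k x m h0 => ?_⟩
  · rw [← h.initial n]
    exact hf.measureReal_preimage (hm 0 n).nullMeasurableSet
  · have hE := measurableSet_forall_le h.measurable x k
    have e1 : {ω | ∀ j ≤ k, X j (f ω) = x j} = f ⁻¹' {ω | ∀ j ≤ k, X j ω = x j} := rfl
    have e2 : {ω | X (k + 1) (f ω) = m} = f ⁻¹' {ω | X (k + 1) ω = m} := rfl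
    rw [e1, hf.measure_preimage hE.nullMeasurableSet] at h0
    rw [← h.transition k x m h0, e1, e2, measureReal_def, measureReal_def, cond_apply hE,
      cond_apply (hf.measurable hE), ← Set.preimage_inter, hf.measure_preimage hE.nullMeasurableSet,
      hf.measure_preimage (hE.inter (hm _ _)).nullMeasurableSet]

end

section

variable {q σ ρ₀ ρ₁ : ℝ}

/-! # Convergence of the two ends -/

/-- This exhibits the chain as the Doob transform of the weighted Motzkin operator by s, with
eigenvalue 2+2σ. -/
theorem transitionProb_eq (hσ₀ : 0 < σ) {n : ℕ} (hs : s q σ n ≠ 0) (m : ℕ) :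
    transitionProb q σ n m =
      siteWeight q n * stepWeight (2 * σ) n m * s q σ m / ((2 + 2 * σ) * s q σ n) := by
  have h1 : 1 + σ ≠ 0 := by linarith
  have h2 : (2 + 2 * σ) = 2 * (1 + σ) := by ring
  rw [transitionProb, siteWeight, h2]
  unfold stepWeight
  rcases eq_or_ne m n with rfl | hmn
  · rw [if_neg (by omega), if_pos rfl, if_pos rfl]
    field_simp
  · rw [if_neg hmn, if_neg hmn]
    by_cases hm1 : m = n + 1
    · rw [if_pos hm1, if_pos (.inl hm1)]
      field_simp
    · rw [if_neg hm1]
      by_cases hm2 : m + 1 = n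
      · rw [if_pos hm2, if_pos (.inr hm2.symm)]
        field_simp
      · rw [if_neg hm2, if_neg (by omega)]
        simp

/-- The quotients s(x_{j+1})/s(x_j) telescope. -/
theorem initialProb_mul_prod_transitionProb {ρ : ℝ} (hq₀ : 0 ≤ q) (hq₁ : q < 1) (hσ₀ : 0 < σ)
    (hσ₁ : σ ≤ 1) (x : ℕ → ℕ) (k : ℕ) :
    initialProb q σ ρ (x 0) * ∏ j ∈ Finset.range k, transitionProb q σ (x j) (x (j + 1)) =
      endLimit q σ ρ k x := by
  have hs := fun n => (s_pos hq₀ hq₁ hσ₀ hσ₁ n).ne'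
  induction k with
  | zero => simp [initialProb, endLimit, prefixWeight]
  | succ k ih =>
    rw [Finset.prod_range_succ, ← mul_assoc, ih, transitionProb_eq hσ₀ (hs _), endLimit, endLimit,
      prefixWeight, prefixWeight, Finset.prod_range_succ, pow_succ, div_mul_div_comm]
    rw [← mul_div_mul_right _ ((2 + 2 * σ) ^ k * (2 + 2 * σ) * normConst q σ ρ) (hs (x k))]
    congr 1 <;> ring

theorem transitionProb_nonneg (hq₀ : 0 ≤ q) (hq₁ : q < 1) (hσ₀ : 0 < σ) (hσ₁ : σ ≤ 1) (n m : ℕ) :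
    0 ≤ transitionProb q σ n m := by
  have hs := s_pos hq₀ hq₁ hσ₀ hσ₁
  rw [transitionProb_eq hσ₀ (hs n).ne']
  exact div_nonneg (mul_nonneg (mul_nonneg ((admissible_siteWeight hq₀ hq₁ hσ₀ hσ₁).pos n).le
    (stepWeight_nonneg (by linarith) _ _)) (hs m).le)
    (mul_nonneg (by linarith) (hs n).le)

/-- Total mass one is the eigenvalue equation for s divided by (2+2σ)s_n. -/
theorem tsum_ofReal_transitionProb (hq₀ : 0 ≤ q) (hq₁ : q < 1) (hσ₀ : 0 < σ) (hσ₁ : σ ≤ 1)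
    (n : ℕ) : ∑' m, ENNReal.ofReal (transitionProb q σ n m) = 1 := by
  have h := admissible_siteWeight hq₀ hq₁ hσ₀ hσ₁
  have hs := s_pos hq₀ hq₁ hσ₀ hσ₁
  have hσ : 0 ≤ 2 * σ := by linarith
  have hΛ : 0 < 2 + 2 * σ := by linarith
  have hc : 0 ≤ siteWeight q n / ((2 + 2 * σ) * s q σ n) :=
    div_nonneg (h.pos n).le (mul_pos hΛ (hs n)).le
  have h1 : ∀ m, ENNReal.ofReal (transitionProb q σ n m) =
      ENNReal.ofReal (siteWeight q n / ((2 + 2 * σ) * s q σ n)) *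
        (stepWeight (ENNReal.ofReal (2 * σ)) n m * ENNReal.ofReal (s q σ m)) := fun m => by
    rw [transitionProb_eq hσ₀ (hs n).ne', ← ofReal_stepWeight,
      ← ENNReal.ofReal_mul (stepWeight_nonneg hσ _ _), ← ENNReal.ofReal_mul hc]
    congr 1
    ring
  have h2 := mul_motzkinStep_orthPoly (σ := σ) (x := 2 + 2 * σ) h.pos n
  simp only [← funext (s_eq_orthPoly hq₀ hq₁ hσ₀ hσ₁)] at h2
  rw [tsum_congr h1, ENNReal.tsum_mul_left, tsum_stepWeight_mul,
    ← ofReal_motzkinStep hσ fun m => (hs m).le, ← ENNReal.ofReal_mul hc, div_mul_eq_mul_div, h2,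
    div_self (mul_pos hΛ (hs n)).ne', ENNReal.ofReal_one]

theorem initialProb_nonneg {ρ : ℝ} (hq₀ : 0 ≤ q) (hq₁ : q < 1) (hσ₀ : 0 < σ) (hσ₁ : σ ≤ 1)
    (hρ : 0 ≤ ρ) (hρ' : ρ < 1) (n : ℕ) : 0 ≤ initialProb q σ ρ n :=
  div_nonneg (mul_nonneg (pow_nonneg hρ n) (s_pos hq₀ hq₁ hσ₀ hσ₁ n).le)
    (normConst_pos hq₀ hq₁ hσ₀ hσ₁ hρ hρ').le

theorem tsum_ofReal_initialProb {ρ : ℝ} (hq₀ : 0 ≤ q) (hq₁ : q < 1) (hσ₀ : 0 < σ) (hσ₁ : σ ≤ 1)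
    (hρ : 0 ≤ ρ) (hρ' : ρ < 1) : ∑' n, ENNReal.ofReal (initialProb q σ ρ n) = 1 := by
  have h := (hasSum_s_mul_pow (q := q) (σ := σ) (by rwa [abs_of_nonneg hq₀])
    (show |ρ| < 1 by rwa [abs_of_nonneg hρ])).div_const (normConst q σ ρ)
  rw [div_self (normConst_pos hq₀ hq₁ hσ₀ hσ₁ hρ hρ').ne'] at h
  rw [← ENNReal.ofReal_tsum_of_nonneg (initialProb_nonneg hq₀ hq₁ hσ₀ hσ₁ hρ hρ') h.summable]
  exact (congrArg ENNReal.ofReal h.tsum_eq).trans ENNReal.ofReal_one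

theorem exists_isLimitPair (hq₀ : 0 ≤ q) (hq₁ : q < 1) (hσ₀ : 0 < σ) (hσ₁ : σ ≤ 1)
    (hρ₀ : 0 ≤ ρ₀) (hρ₀' : ρ₀ < 1) (hρ₁ : 0 ≤ ρ₁) (hρ₁' : ρ₁ < 1) :
    ∃ (Ω : Type) (_ : MeasurableSpace Ω) (P : Measure Ω) (_ : IsProbabilityMeasure P)
      (X Y : ℕ → Ω → ℕ), IsLimitPair P X Y q σ ρ₀ ρ₁ := by
  obtain ⟨P, hP, hX⟩ := exists_isMarkovChain (initialProb_nonneg hq₀ hq₁ hσ₀ hσ₁ hρ₀ hρ₀')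
    (tsum_ofReal_initialProb hq₀ hq₁ hσ₀ hσ₁ hρ₀ hρ₀') (transitionProb_nonneg hq₀ hq₁ hσ₀ hσ₁)
    (tsum_ofReal_transitionProb hq₀ hq₁ hσ₀ hσ₁)
  obtain ⟨Q, hQ, hY⟩ := exists_isMarkovChain (initialProb_nonneg hq₀ hq₁ hσ₀ hσ₁ hρ₁ hρ₁')
    (tsum_ofReal_initialProb hq₀ hq₁ hσ₀ hσ₁ hρ₁ hρ₁') (transitionProb_nonneg hq₀ hq₁ hσ₀ hσ₁)
    (tsum_ofReal_transitionProb hq₀ hq₁ hσ₀ hσ₁)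
  refine ⟨(ℕ → ℕ) × (ℕ → ℕ), inferInstance, P.prod Q, inferInstance, fun k ω => ω.1 k,
    fun k ω => ω.2 k, hX.comp measurePreserving_fst, hY.comp measurePreserving_snd, ?_⟩
  exact indepFun_prod (X := fun ω : ℕ → ℕ => ω) (Y := fun ω : ℕ → ℕ => ω) measurable_id
    measurable_id

/-! ### Weak convergence from cylinders -/

theorem measurableSet_cylinder (k : ℕ) (x y : ℕ → ℕ) : MeasurableSet (cylinder k x y) :=
  ((measurableSet_forall_le (X := fun j (ω : ℕ → ℕ) => ω j) (fun j => measurable_pi_apply j) x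
    k).preimage measurable_fst).inter ((measurableSet_forall_le (X := fun j (ω : ℕ → ℕ) => ω j)
      (fun j => measurable_pi_apply j) y k).preimage measurable_snd)

theorem cylinder_eq_of_mem {k : ℕ} {x y : ℕ → ℕ} {p : (ℕ → ℕ) × (ℕ → ℕ)}
    (hp : p ∈ cylinder k x y) : cylinder k x y = cylinder k p.1 p.2 := by
  ext r
  refine and_congr (forall₂_congr fun j hj => ?_) (forall₂_congr fun j hj => ?_)
  · rw [hp.1 j hj]
  · rw [hp.2 j hj]

/-- Any point of a cylinder may serve as its centre, so two that meet can be recentred at a common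
point. -/
theorem isPiSystem_cylinder : IsPiSystem {S | ∃ k x y, S = cylinder k x y} := by
  rintro _ ⟨k, x, y, rfl⟩ _ ⟨l, x', y', rfl⟩ ⟨p, hp, hp'⟩
  refine ⟨max k l, p.1, p.2, ?_⟩
  rw [cylinder_eq_of_mem hp, cylinder_eq_of_mem hp']
  ext r
  constructor
  · rintro ⟨h1, h2⟩
    refine ⟨fun j hj => ?_, fun j hj => ?_⟩
    · exact (le_max_iff.mp hj).elim (h1.1 j) (h2.1 j)
    · exact (le_max_iff.mp hj).elim (h1.2 j) (h2.2 j)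
  · rintro ⟨h1, h2⟩
    exact ⟨⟨fun j hj => h1 j (hj.trans (le_max_left _ _)),
        fun j hj => h2 j (hj.trans (le_max_left _ _))⟩,
      ⟨fun j hj => h1 j (hj.trans (le_max_right _ _)),
        fun j hj => h2 j (hj.trans (le_max_right _ _))⟩⟩

theorem isOpen_cylinder (k : ℕ) (x y : ℕ → ℕ) : IsOpen (cylinder k x y) := by
  have h : cylinder k x y = (⋂ j ∈ Set.Iic k, {p | p.1 j = x j}) ∩
      ⋂ j ∈ Set.Iic k, {p | p.2 j = y j} := by
    ext p; simp [cylinder]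
  have h1 : ∀ j, Continuous fun p : (ℕ → ℕ) × (ℕ → ℕ) => p.1 j := by fun_prop
  have h2 : ∀ j, Continuous fun p : (ℕ → ℕ) × (ℕ → ℕ) => p.2 j := by fun_prop
  rw [h]
  refine ((Set.finite_Iic k).isOpen_biInter fun j _ => ?_).inter
    ((Set.finite_Iic k).isOpen_biInter fun j _ => ?_)
  · exact (isOpen_discrete {x j}).preimage (h1 j)
  · exact (isOpen_discrete {y j}).preimage (h2 j)

theorem exists_forall_le_subset {u : Set (ℕ → ℕ)} {x : ℕ → ℕ} (hu : u ∈ 𝓝 x) :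
    ∃ k, ∀ z : ℕ → ℕ, (∀ j ≤ k, z j = x j) → z ∈ u := by
  rw [nhds_pi, Filter.mem_pi] at hu
  obtain ⟨I, hI, t, ht, hsub⟩ := hu
  obtain ⟨k, hk⟩ := hI.bddAbove
  refine ⟨k, fun z hz => hsub fun j hj => ?_⟩
  rw [hz j (hk hj)]
  exact mem_of_mem_nhds (ht j)

theorem exists_cylinder_subset {u : Set ((ℕ → ℕ) × (ℕ → ℕ))} (hu : IsOpen u)
    {p : (ℕ → ℕ) × (ℕ → ℕ)} (hp : p ∈ u) : ∃ k, cylinder k p.1 p.2 ⊆ u := by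
  obtain ⟨v, hv, w, hw, hsub⟩ := mem_nhds_prod_iff.mp (hu.mem_nhds hp)
  obtain ⟨k, hk⟩ := exists_forall_le_subset hv
  obtain ⟨l, hl⟩ := exists_forall_le_subset hw
  refine ⟨max k l, fun r hr => hsub ⟨hk _ fun j hj => ?_, hl _ fun j hj => ?_⟩⟩
  · exact hr.1 j (hj.trans (le_max_left _ _))
  · exact hr.2 j (hj.trans (le_max_right _ _))

/-- Probability measures on pairs of sequences converge weakly as soon as they converge on
cylinders. -/
theorem tendsto_of_tendsto_cylinder {μ : ℕ → ProbabilityMeasure ((ℕ → ℕ) × (ℕ → ℕ))}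
    {ν : ProbabilityMeasure ((ℕ → ℕ) × (ℕ → ℕ))}
    (h : ∀ k x y, Tendsto (fun i => (μ i : Measure _) (cylinder k x y)) atTop
      (𝓝 ((ν : Measure _) (cylinder k x y)))) : Tendsto μ atTop (𝓝 ν) := by
  refine isPiSystem_cylinder.tendsto_probabilityMeasure_of_tendsto_of_mem ?_ ?_ ?_
  · rintro _ ⟨k, x, y, rfl⟩
    exact measurableSet_cylinder k x y
  · intro u hu p hp
    obtain ⟨k, hk⟩ := exists_cylinder_subset hu hp
    exact ⟨_, ⟨k, p.1, p.2, rfl⟩,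
      (isOpen_cylinder k p.1 p.2).mem_nhds ⟨fun _ _ => rfl, fun _ _ => rfl⟩, hk⟩
  · rintro _ ⟨k, x, y, rfl⟩
    exact (ENNReal.tendsto_toNNReal (measure_ne_top _ _)).comp (h k x y)

/-- Independence factors the cylinder, and the Markov property determines each factor; hence every
limit pair has the same law. -/
theorem IsLimitPair.measure_cylinder {Ω : Type*} [MeasurableSpace Ω] {P : Measure Ω}
    [IsProbabilityMeasure P] {X Y : ℕ → Ω → ℕ} (hq₀ : 0 ≤ q) (hq₁ : q < 1) (hσ₀ : 0 < σ)
    (hσ₁ : σ ≤ 1) (h : IsLimitPair P X Y q σ ρ₀ ρ₁) (k : ℕ) (x y : ℕ → ℕ) :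
    P ((fun ω => (fun k => X k ω, fun k => Y k ω)) ⁻¹' cylinder k x y) =
      ENNReal.ofReal (endLimit q σ ρ₀ k x * endLimit q σ ρ₁ k y) := by
  have hm : ∀ x : ℕ → ℕ, MeasurableSet {z : ℕ → ℕ | ∀ j ≤ k, z j = x j} := fun x =>
    measurableSet_forall_le (X := fun j (ω : ℕ → ℕ) => ω j) (fun j => measurable_pi_apply j) x k
  have h1 := h.indep.measure_inter_preimage_eq_mul _ _ (hm x) (hm y)
  have h2 : P ((fun ω k => X k ω) ⁻¹' {z | ∀ j ≤ k, z j = x j}) =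
      ENNReal.ofReal (endLimit q σ ρ₀ k x) := by
    rw [← initialProb_mul_prod_transitionProb hq₀ hq₁ hσ₀ hσ₁,
      ← h.left.measureReal_forall_le, ofReal_measureReal]
    rfl
  have h3 : P ((fun ω k => Y k ω) ⁻¹' {z | ∀ j ≤ k, z j = y j}) =
      ENNReal.ofReal (endLimit q σ ρ₁ k y) := by
    rw [← initialProb_mul_prod_transitionProb hq₀ hq₁ hσ₀ hσ₁,
      ← h.right.measureReal_forall_le, ofReal_measureReal]
    rfl
  have h4 : 0 ≤ endLimit q σ ρ₀ k x := by
    rw [← initialProb_mul_prod_transitionProb hq₀ hq₁ hσ₀ hσ₁, ← h.left.measureReal_forall_le]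
    exact measureReal_nonneg
  rw [h2, h3, ← ENNReal.ofReal_mul h4] at h1
  exact h1

end

end QMotzkin

end

theorem theorem1 (q σ ρ₀ ρ₁ : ℝ) (hq₀ : 0 ≤ q) (hq₁ : q < 1) (hσ₀ : 0 < σ) (hσ₁ : σ ≤ 1)
    (hρ₀ : 0 ≤ ρ₀) (hρ₀' : ρ₀ < 1) (hρ₁ : 0 ≤ ρ₁) (hρ₁' : ρ₁ < 1) :
    -- the weights are summable with positive sum, so that the path measures are well defined
    ∃ _ : ∀ L : ℕ, IsProbabilityMeasure (QMotzkin.motzkinLaw q σ ρ₀ ρ₁ L),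
      -- two independent Markov chains with the stated laws exist
      (∃ (Ω : Type) (_ : MeasurableSpace Ω) (P : Measure Ω) (_ : IsProbabilityMeasure P)
        (X Y : ℕ → Ω → ℕ), QMotzkin.IsLimitPair P X Y q σ ρ₀ ρ₁) ∧
      -- any such pair is the limit in distribution of the two ends of the random path
      ∀ (Ω : Type*) (_ : MeasurableSpace Ω) (P : Measure Ω) (_ : IsProbabilityMeasure P)
        (X Y : ℕ → Ω → ℕ), QMotzkin.IsLimitPair P X Y q σ ρ₀ ρ₁ →
        TendstoInDistribution (E := (ℕ → ℕ) × (ℕ → ℕ))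
          (fun (L : ℕ) (γ : QMotzkin.MotzkinPath L) => (γ.fromStart, γ.fromEnd)) atTop
          (fun ω => (fun k => X k ω, fun k => Y k ω))
          (fun L => QMotzkin.motzkinLaw q σ ρ₀ ρ₁ L) P := by
  have hprob := QMotzkin.isProbabilityMeasure_motzkinLaw hq₀ hq₁ hσ₀ hσ₁ hρ₀ hρ₀' hρ₁ hρ₁'
  refine ⟨hprob, QMotzkin.exists_isLimitPair hq₀ hq₁ hσ₀ hσ₁ hρ₀ hρ₀' hρ₁ hρ₁', fun Ω _ P _ X Y h => ?_⟩
  have hZ : Measurable fun ω => ((fun k => X k ω, fun k => Y k ω) : (ℕ → ℕ) × (ℕ → ℕ)) :=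
    (measurable_pi_lambda _ h.left.measurable).prodMk (measurable_pi_lambda _ h.right.measurable)
  refine ⟨fun L => Measurable.aemeasurable measurable_from_top, hZ.aemeasurable,
    QMotzkin.tendsto_of_tendsto_cylinder fun k x y => ?_⟩
  have hcyl := QMotzkin.measurableSet_cylinder k x y
  simp only [ProbabilityMeasure.coe_mk]
  rw [Measure.map_apply hZ hcyl, h.measure_cylinder hq₀ hq₁ hσ₀ hσ₁]
  refine (QMotzkin.tendsto_motzkinLaw_cylinder hq₀ hq₁ hσ₀ hσ₁ hρ₀ hρ₀' hρ₁ hρ₁' k x y).congr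
    fun L => ?_
  rw [Measure.map_apply measurable_from_top hcyl]
  rfl
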